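/- Let $U,V$ be independent standard Gaussian random variables (mean $0$, variance $1$). Let $\vartheta,g\in\mathbb R$, $k>0$, $\lambda>0$, $h\ge 0$ with $k^2\ne\lambda$, and let $$\mathscr D=\{(u,v):\sqrt{\lambda v^2+h}\le u-\vartheta\le kv+g\}.$$ Put $\Delta=h(k^2-\lambda)+\lambda g^2$, $$u_A=\frac{\lambda g-k\sqrt\Delta}{\lambda-k^2}+\vartheta,\quad u_B=\frac{\lambda g+k\sqrt\Delta}{\lambda-k^2}+\vartheta,\quad v_A=\frac{gk-\sqrt\Delta}{\lambda-k^2},\quad v_B=\frac{gk+\sqrt\Delta}{\lambda-k^2},$$ $$\phi_A=\arccos\frac{u_A}{\sqrt{u_A^2+v_A^2}},\quad \phi_B=\arccos\frac{u_B}{\sqrt{u_B^2+v_B^2}},\quad \phi_m=\arctan\sqrt{\frac{h}{\lambda|\vartheta^2-h|}},\quad \phi_\lambda=\arctan\frac1{\sqrt\lambda},\quad \phi_k=\arctan k,$$ $$\Psi(\phi)=\frac1{2\pi}\exp\Big(-\frac{(\vartheta+g)^2}{2(1+k^2)\cos^2\phi}\Big),\quad \Upsilon(\phi)=\frac1{2\pi}\exp\Bigg(-\frac{(\vartheta^2-h)^2}{2\big[\vartheta\cos\phi+\sqrt{(h+\lambda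 h-\lambda\vartheta^2)\cos^2\phi+\lambda(\vartheta^2-h)}\,\big]^2}\Bigg),$$ and $t_A=\vartheta+\frac{h}{u_A-\vartheta}$, $t_B=\vartheta+\frac{h}{u_B-\vartheta}$ (the quotient in $t_A$ is read as $0$ when $h=u_A-\vartheta=0$). Then $$\Pr\{(U,V)\in\mathscr D\}=\begin{cases}I_{np}& k^2<\lambda,\ g>\sqrt h,\ \Delta\ge0,\\ I_{pp}& k^2<\lambda,\ 0<g\le\sqrt h,\ \Delta\ge0,\\ I_{n}& k^2>\lambda,\ gk>\sqrt\Delta,\\ I_{p}& k^2>\lambda,\ gk\le\sqrt\Delta,\\ 0&\text{otherwise,}\end{cases}$$ where in the first four cases it is assumed that $\vartheta^2\ne h$ (if $\vartheta^2=h$ then $\phi_m$ and $\Upsilon$ contain divisions $h/0$ or $0/0$), and where $$I_{np}=\begin{cases}I_{np,1}& t_B\ge0,\\ I_{np,2}& t_B<0\le t_A,\\ I_{np,3}& t_A<0\le\vartheta+\sqrt h,\\ I_{np,4}&\vartheta+\sqrt h<0\le\vartheta+g,\\ I_{np,5}&\vartheta+g<0,\end{cases}\qquad I_{n}=\begin{cases}I_{n,1}&\vartheta\ge0,\\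 I_{n,2}&\vartheta<0\le t_A,\\ I_{n,3}& t_A<0\le\vartheta+\sqrt h,\\ I_{n,4}&\vartheta+\sqrt h<0\le\vartheta+g,\\ I_{n,5}&\vartheta+g<0,\end{cases}$$ $$I_{pp}=\begin{cases}I_{pp,1}& t_B\ge0,\\ I_{pp,2}& t_B<0\le t_A,\\ I_{pp,3}& t_A<0,\end{cases}\qquad I_{p}=\begin{cases}I_{p,1}&\vartheta\ge0,\\ I_{p,2}&\vartheta<0\le t_A,\\ I_{p,3}& t_A<0,\end{cases}$$ with (all integrals oriented, in $d\phi$) $$\begin{aligned} I_{np,1}&=\int_{\pi-\phi_A}^{\pi+\phi_B}\Upsilon-\int_{\phi_k-\phi_A}^{\phi_k+\phi_B}\Psi,\\ I_{np,2}&=\int_{\pi-\phi_A}^{\pi+\phi_m}\Upsilon-\int_{\phi_B}^{\phi_m}\Upsilon-\int_{\phi_k-\phi_A}^{\phi_k+\phi_B}\Psi,\\ I_{np,3}&=\int_{\pi-\phi_m}^{\pi+\phi_m}\Upsilon-\int_{\phi_B}^{\phi_m}\Upsilon-\int_{\phi_A}^{\phi_m}\Upsilon-\int_{\phi_k-\phi_A}^{\phi_k+\phi_B}\Psi,\\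 I_{np,4}&=1-\int_{\phi_k-\phi_A}^{\phi_k+\phi_B}\Psi-\int_{\phi_B}^{2\pi-\phi_A}\Upsilon,\\ I_{np,5}&=\int_{\phi_k+\phi_B}^{\phi_k-\phi_A+2\pi}\Psi-\int_{\phi_B}^{2\pi-\phi_A}\Upsilon,\\ I_{n,1}&=\int_{\pi-\phi_A}^{\pi+\phi_\lambda}\Upsilon-\int_{\phi_k-\phi_A}^{\pi/2}\Psi,\\ I_{n,2}&=\int_{\pi-\phi_A}^{\pi+\phi_m}\Upsilon-\int_{\phi_\lambda}^{\phi_m}\Upsilon-\int_{\phi_k-\phi_A}^{\pi/2}\Psi,\\ I_{n,3}&=\int_{\pi-\phi_m}^{\pi+\phi_m}\Upsilon-\int_{\phi_\lambda}^{\phi_m}\Upsilon-\int_{\phi_A}^{\phi_m}\Upsilon-\int_{\phi_k-\phi_A}^{\pi/2}\Psi,\\ I_{n,4}&=1-\int_{\phi_k-\phi_A}^{\pi/2}\Psi-\int_{\phi_\lambda}^{2\pi-\phi_A}\Upsilon,\\ I_{n,5}&=\int_{\pi/2}^{\phi_k-\phi_A+2\pi}\Psi-\int_{\phi_\lambda}^{2\pi-\phi_A}\Upsilon,\\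 I_{pp,1}&=\int_{\pi+\phi_A}^{\pi+\phi_B}\Upsilon-\int_{\phi_k+\phi_A}^{\phi_k+\phi_B}\Psi,\\ I_{pp,2}&=\int_{\pi+\phi_A}^{\pi+\phi_m}\Upsilon-\int_{\phi_B}^{\phi_m}\Upsilon-\int_{\phi_k+\phi_A}^{\phi_k+\phi_B}\Psi,\\ I_{pp,3}&=\int_{\phi_k+\phi_B}^{\phi_k+\phi_A}\Psi-\int_{\phi_B}^{\phi_A}\Upsilon,\\ I_{p,1}&=\int_{\pi/2}^{\phi_k+\phi_A}\Psi+\int_{\pi+\phi_A}^{\pi+\phi_\lambda}\Upsilon,\\ I_{p,2}&=\int_{\pi/2}^{\phi_k+\phi_A}\Psi+\int_{\pi+\phi_A}^{\pi+\phi_m}\Upsilon-\int_{\phi_\lambda}^{\phi_m}\Upsilon,\\ I_{p,3}&=\int_{\pi/2}^{\phi_k+\phi_A}\Psi-\int_{\phi_\lambda}^{\phi_A}\Upsilon. \end{aligned}$$ -/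

import Mathlib

open MeasureTheory ProbabilityTheory

namespace GaussHyperbola

noncomputable section

open Real

/-- The closed planar domain bounded by a right hyperbola branch (on the left) and a line
(on the right). -/
def domainD (ϑ lam h k g : ℝ) : Set (ℝ × ℝ) :=
  {p | √(lam * p.2 ^ 2 + h) ≤ p.1 - ϑ ∧ p.1 - ϑ ≤ k * p.2 + g}

/-- The (reduced) discriminant of the intersection equation of the line and the hyperbola. -/
def Delta (lam h k g : ℝ) : ℝ := h * (k ^ 2 - lam) + lam * g ^ 2

def uA (ϑ lam h k g : ℝ) : ℝ :=
  (lam * g - k * √(Delta lam h k g)) / (lam - k ^ 2) + ϑ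

def uB (ϑ lam h k g : ℝ) : ℝ :=
  (lam * g + k * √(Delta lam h k g)) / (lam - k ^ 2) + ϑ

def vA (lam h k g : ℝ) : ℝ := (g * k - √(Delta lam h k g)) / (lam - k ^ 2)

def vB (lam h k g : ℝ) : ℝ := (g * k + √(Delta lam h k g)) / (lam - k ^ 2)

/-- The angle (in `[0, π]`) between the `u`-axis and the intersection point `A = (uA, vA)`. -/
def phiA (ϑ lam h k g : ℝ) : ℝ :=
  arccos (uA ϑ lam h k g / √(uA ϑ lam h k g ^ 2 + vA lam h k g ^ 2))

/-- The angle (in `[0, π]`) between the `u`-axis and the intersection point `B = (uB, vB)`. -/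
def phiB (ϑ lam h k g : ℝ) : ℝ :=
  arccos (uB ϑ lam h k g / √(uB ϑ lam h k g ^ 2 + vB lam h k g ^ 2))

def phiM (ϑ lam h : ℝ) : ℝ := arctan (√(h / (lam * |ϑ ^ 2 - h|)))

def phiLam (lam : ℝ) : ℝ := arctan (1 / √lam)

def phiK (k : ℝ) : ℝ := arctan k

def Psi (ϑ g k φ : ℝ) : ℝ :=
  1 / (2 * π) * exp (-((ϑ + g) ^ 2 / (2 * (1 + k ^ 2) * cos φ ^ 2)))

def Upsilon (ϑ lam h φ : ℝ) : ℝ :=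
  1 / (2 * π) * exp (-((ϑ ^ 2 - h) ^ 2 /
    (2 * (ϑ * cos φ +
      √((h + lam * h - lam * ϑ ^ 2) * cos φ ^ 2 + lam * (ϑ ^ 2 - h))) ^ 2)))

/-- The abscissa at which the tangent line to the hyperbola at `A` meets the `u`-axis. -/
def tanA (ϑ lam h k g : ℝ) : ℝ := ϑ + h / (uA ϑ lam h k g - ϑ)

/-- The abscissa at which the tangent line to the hyperbola at `B` meets the `u`-axis. -/
def tanB (ϑ lam h k g : ℝ) : ℝ := ϑ + h / (uB ϑ lam h k g - ϑ)

def Inp1 (ϑ lam h k g : ℝ) : ℝ :=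
  (∫ φ in (π - phiA ϑ lam h k g)..(π + phiB ϑ lam h k g), Upsilon ϑ lam h φ)
    - (∫ φ in (phiK k - phiA ϑ lam h k g)..(phiK k + phiB ϑ lam h k g), Psi ϑ g k φ)

def Inp2 (ϑ lam h k g : ℝ) : ℝ :=
  (∫ φ in (π - phiA ϑ lam h k g)..(π + phiM ϑ lam h), Upsilon ϑ lam h φ)
    - (∫ φ in (phiB ϑ lam h k g)..(phiM ϑ lam h), Upsilon ϑ lam h φ)
    - (∫ φ in (phiK k - phiA ϑ lam h k g)..(phiK k + phiB ϑ lam h k g), Psi ϑ g k φ)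

def Inp3 (ϑ lam h k g : ℝ) : ℝ :=
  (∫ φ in (π - phiM ϑ lam h)..(π + phiM ϑ lam h), Upsilon ϑ lam h φ)
    - (∫ φ in (phiB ϑ lam h k g)..(phiM ϑ lam h), Upsilon ϑ lam h φ)
    - (∫ φ in (phiA ϑ lam h k g)..(phiM ϑ lam h), Upsilon ϑ lam h φ)
    - (∫ φ in (phiK k - phiA ϑ lam h k g)..(phiK k + phiB ϑ lam h k g), Psi ϑ g k φ)

def Inp4 (ϑ lam h k g : ℝ) : ℝ :=
  1
    - (∫ φ in (phiK k - phiA ϑ lam h k g)..(phiK k + phiB ϑ lam h k g), Psi ϑ g k φ)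
    - (∫ φ in (phiB ϑ lam h k g)..(2 * π - phiA ϑ lam h k g), Upsilon ϑ lam h φ)

def Inp5 (ϑ lam h k g : ℝ) : ℝ :=
  (∫ φ in (phiK k + phiB ϑ lam h k g)..(phiK k - phiA ϑ lam h k g + 2 * π), Psi ϑ g k φ)
    - (∫ φ in (phiB ϑ lam h k g)..(2 * π - phiA ϑ lam h k g), Upsilon ϑ lam h φ)

def In1 (ϑ lam h k g : ℝ) : ℝ :=
  (∫ φ in (π - phiA ϑ lam h k g)..(π + phiLam lam), Upsilon ϑ lam h φ)
    - (∫ φ in (phiK k - phiA ϑ lam h k g)..(π / 2), Psi ϑ g k φ)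

def In2 (ϑ lam h k g : ℝ) : ℝ :=
  (∫ φ in (π - phiA ϑ lam h k g)..(π + phiM ϑ lam h), Upsilon ϑ lam h φ)
    - (∫ φ in (phiLam lam)..(phiM ϑ lam h), Upsilon ϑ lam h φ)
    - (∫ φ in (phiK k - phiA ϑ lam h k g)..(π / 2), Psi ϑ g k φ)

def In3 (ϑ lam h k g : ℝ) : ℝ :=
  (∫ φ in (π - phiM ϑ lam h)..(π + phiM ϑ lam h), Upsilon ϑ lam h φ)
    - (∫ φ in (phiLam lam)..(phiM ϑ lam h), Upsilon ϑ lam h φ)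
    - (∫ φ in (phiA ϑ lam h k g)..(phiM ϑ lam h), Upsilon ϑ lam h φ)
    - (∫ φ in (phiK k - phiA ϑ lam h k g)..(π / 2), Psi ϑ g k φ)

def In4 (ϑ lam h k g : ℝ) : ℝ :=
  1
    - (∫ φ in (phiK k - phiA ϑ lam h k g)..(π / 2), Psi ϑ g k φ)
    - (∫ φ in (phiLam lam)..(2 * π - phiA ϑ lam h k g), Upsilon ϑ lam h φ)

def In5 (ϑ lam h k g : ℝ) : ℝ :=
  (∫ φ in (π / 2)..(phiK k - phiA ϑ lam h k g + 2 * π), Psi ϑ g k φ)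
    - (∫ φ in (phiLam lam)..(2 * π - phiA ϑ lam h k g), Upsilon ϑ lam h φ)

def Ipp1 (ϑ lam h k g : ℝ) : ℝ :=
  (∫ φ in (π + phiA ϑ lam h k g)..(π + phiB ϑ lam h k g), Upsilon ϑ lam h φ)
    - (∫ φ in (phiK k + phiA ϑ lam h k g)..(phiK k + phiB ϑ lam h k g), Psi ϑ g k φ)

def Ipp2 (ϑ lam h k g : ℝ) : ℝ :=
  (∫ φ in (π + phiA ϑ lam h k g)..(π + phiM ϑ lam h), Upsilon ϑ lam h φ)
    - (∫ φ in (phiB ϑ lam h k g)..(phiM ϑ lam h), Upsilon ϑ lam h φ)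
    - (∫ φ in (phiK k + phiA ϑ lam h k g)..(phiK k + phiB ϑ lam h k g), Psi ϑ g k φ)

def Ipp3 (ϑ lam h k g : ℝ) : ℝ :=
  (∫ φ in (phiK k + phiB ϑ lam h k g)..(phiK k + phiA ϑ lam h k g), Psi ϑ g k φ)
    - (∫ φ in (phiB ϑ lam h k g)..(phiA ϑ lam h k g), Upsilon ϑ lam h φ)

def Ip1 (ϑ lam h k g : ℝ) : ℝ :=
  (∫ φ in (π / 2)..(phiK k + phiA ϑ lam h k g), Psi ϑ g k φ)
    + (∫ φ in (π + phiA ϑ lam h k g)..(π + phiLam lam), Upsilon ϑ lam h φ)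

def Ip2 (ϑ lam h k g : ℝ) : ℝ :=
  (∫ φ in (π / 2)..(phiK k + phiA ϑ lam h k g), Psi ϑ g k φ)
    + (∫ φ in (π + phiA ϑ lam h k g)..(π + phiM ϑ lam h), Upsilon ϑ lam h φ)
    - (∫ φ in (phiLam lam)..(phiM ϑ lam h), Upsilon ϑ lam h φ)

def Ip3 (ϑ lam h k g : ℝ) : ℝ :=
  (∫ φ in (π / 2)..(phiK k + phiA ϑ lam h k g), Psi ϑ g k φ)
    - (∫ φ in (phiLam lam)..(phiA ϑ lam h k g), Upsilon ϑ lam h φ)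

/-- The last case is `ϑ + g < 0`. -/
def Inp (ϑ lam h k g : ℝ) : ℝ :=
  if 0 ≤ tanB ϑ lam h k g then Inp1 ϑ lam h k g
  else if tanB ϑ lam h k g < 0 ∧ 0 ≤ tanA ϑ lam h k g then Inp2 ϑ lam h k g
  else if tanA ϑ lam h k g < 0 ∧ 0 ≤ ϑ + √h then Inp3 ϑ lam h k g
  else if ϑ + √h < 0 ∧ 0 ≤ ϑ + g then Inp4 ϑ lam h k g
  else Inp5 ϑ lam h k g

/-- The last case is `ϑ + g < 0`. -/
def In (ϑ lam h k g : ℝ) : ℝ :=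
  if 0 ≤ ϑ then In1 ϑ lam h k g
  else if ϑ < 0 ∧ 0 ≤ tanA ϑ lam h k g then In2 ϑ lam h k g
  else if tanA ϑ lam h k g < 0 ∧ 0 ≤ ϑ + √h then In3 ϑ lam h k g
  else if ϑ + √h < 0 ∧ 0 ≤ ϑ + g then In4 ϑ lam h k g
  else In5 ϑ lam h k g

/-- The last case is `tanA < 0`. -/
def Ipp (ϑ lam h k g : ℝ) : ℝ :=
  if 0 ≤ tanB ϑ lam h k g then Ipp1 ϑ lam h k g
  else if tanB ϑ lam h k g < 0 ∧ 0 ≤ tanA ϑ lam h k g then Ipp2 ϑ lam h k g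
  else Ipp3 ϑ lam h k g

/-- The last case is `tanA < 0`. -/
def Ip (ϑ lam h k g : ℝ) : ℝ :=
  if 0 ≤ ϑ then Ip1 ϑ lam h k g
  else if ϑ < 0 ∧ 0 ≤ tanA ϑ lam h k g then Ip2 ϑ lam h k g
  else Ip3 ϑ lam h k g

/-- The piecewise value of the probability. -/
def formula (ϑ lam h k g : ℝ) : ℝ :=
  if k ^ 2 < lam ∧ √h < g ∧ 0 ≤ Delta lam h k g then Inp ϑ lam h k g
  else if k ^ 2 < lam ∧ 0 < g ∧ g ≤ √h ∧ 0 ≤ Delta lam h k g then Ipp ϑ lam h k g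
  else if lam < k ^ 2 ∧ √(Delta lam h k g) < g * k then In ϑ lam h k g
  else if lam < k ^ 2 ∧ g * k ≤ √(Delta lam h k g) then Ip ϑ lam h k g
  else 0

end

end GaussHyperbola

namespace GaussHyperbola

noncomputable section

open Real Set Filter Topology

/-! Both `gaussPdf v * gaussCdf u dv` and `(1 - exp (-r ^ 2 / 2)) dθ / (2 π)` have the Gaussian
density times `du ∧ dv` as exterior derivative, and the second form extends smoothly over the origin
because `(1 - exp (-s / 2)) / s` does. Their difference is closed on the whole plane, hence exact
(`exists_potential`). Along a graph `u = f v` the integral of the first form is therefore a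
difference of values of `potential`, plus the change of angle over `2 π`, minus the integral of `exp
(-r ^ 2 / 2) dθ / (2 π)` (`integral_graph`).

On each boundary curve `r` is a function of the angle. On the line, `r * cos (θ + phiK k)` is
constant, which produces `Psi` (`integral_line`). On the branch, `r` solves a quadratic equation,
which produces `Upsilon` at `θ + π` or at `θ`; the sign of `f - v f'` selects the root
(`integral_branch`). This sign can change only where the tangent passes through the origin, that is,
at the angles `±phiM`, and the arcs are cut there.

By Fubini the probability is an integral over the heights at which the line is to the right of the
branch (`measureReal_domainD`). These heights form `[vA, vB]`, or `[vA, ∞)`, or a null set. The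
potentials of the two curves cancel at common endpoints, and in the unbounded case the closing
horizontal segment contributes nothing in the limit (`abs_sub_potential_le`). The angles agree at
the upper end. At `A` they differ by a full turn when the branch passes to the left of the origin
and the line does not; this is the summand `1` of `Inp4` and `In4`. The other cases record the sign
of `vA` and which of the points of tangency lie on the arc. -/

/-- The standard Gaussian density. -/
def gaussPdf (v : ℝ) : ℝ := exp (-(v ^ 2 / 2)) / √(2 * π)

/-- The primitive of the standard Gaussian density that vanishes at `0`. -/
def gaussCdf (u : ℝ) : ℝ := ∫ x in (0 : ℝ)..u, gaussPdf x

lemma continuous_gaussPdf : Continuous gaussPdf := by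
  unfold gaussPdf; fun_prop

lemma gaussPdf_nonneg (v : ℝ) : 0 ≤ gaussPdf v := by unfold gaussPdf; positivity

lemma gaussPdf_eq : gaussPdf = gaussianPDFReal 0 1 := by
  ext v
  simp [gaussPdf, gaussianPDFReal, div_eq_inv_mul]

lemma gaussPdf_mul (u v : ℝ) :
    gaussPdf u * gaussPdf v = 1 / (2 * π) * exp (-((u ^ 2 + v ^ 2) / 2)) := by
  unfold gaussPdf
  rw [div_mul_div_comm, mul_self_sqrt (by positivity), ← Real.exp_add, div_eq_inv_mul, one_div]
  congr 2; ring

lemma hasDerivAt_gaussCdf (u : ℝ) : HasDerivAt gaussCdf (gaussPdf u) u :=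
  (continuous_gaussPdf.integral_hasStrictDerivAt 0 u).hasDerivAt

lemma continuous_gaussCdf : Continuous gaussCdf :=
  continuous_iff_continuousAt.2 fun u => (hasDerivAt_gaussCdf u).continuousAt

/-! ### Two primitives of the Gaussian area form and their exact difference -/

/-- The function `s ↦ (1 - exp (-s / 2)) / (2 π s)`, extended smoothly to `s = 0`. -/
def polarKernel (s : ℝ) : ℝ := 1 / (4 * π) * dslope exp 0 (-s / 2)

lemma mul_polarKernel (s : ℝ) : s * polarKernel s = 1 / (2 * π) * (1 - exp (-(s / 2))) := by
  have h := sub_smul_dslope exp 0 (-s / 2)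
  simp only [sub_zero, smul_eq_mul, Real.exp_zero] at h
  rw [show -(s / 2) = -s / 2 by ring, polarKernel]
  have : 1 - rexp (-s / 2) = s / 2 * dslope rexp 0 (-s / 2) := by linarith
  rw [this]
  field_simp
  ring

lemma differentiable_polarKernel : Differentiable ℝ polarKernel := by
  have h : Differentiable ℝ (dslope exp 0) := by
    intro b
    rcases eq_or_ne b 0 with rfl | hb
    · obtain ⟨p, hp⟩ := (analyticAt_rexp (x := 0))
      exact (HasFPowerSeriesAt.has_fpower_series_dslope_fslope hp).analyticAt.differentiableAt
    · exact (differentiableAt_dslope_of_ne hb).2 Real.differentiableAt_exp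
  unfold polarKernel
  fun_prop

/-- With `s = u ^ 2 + v ^ 2`, the left side is the coefficient of `du ∧ dv` in `d (polarKernel s *
(u dv - v du))`. The identity comes from differentiating `mul_polarKernel`, so it also holds at the
origin. -/
lemma two_mul_deriv_polarKernel (s : ℝ) :
    2 * polarKernel s + 2 * s * deriv polarKernel s = 1 / (2 * π) * exp (-(s / 2)) := by
  have h1 : HasDerivAt (fun s => s * polarKernel s) (1 * polarKernel s + s * deriv polarKernel s) s :=
    (hasDerivAt_id s).mul (differentiable_polarKernel s).hasDerivAt
  have h2 : HasDerivAt (fun s => s * polarKernel s)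
      (1 / (2 * π) * (- (exp (-(s / 2)) * (-(1 / 2))))) s := by
    simp_rw [mul_polarKernel]
    exact ((((hasDerivAt_id s).div_const 2).neg.exp).const_sub 1).const_mul _
  have := h1.unique h2
  linarith

open ContinuousLinearMap in
/-- There is a primitive of the difference between the `1`-form
`gaussPdf v * gaussCdf u dv`, and the `1`-form `(1 - exp (-r ^ 2 / 2)) dθ / (2 π)`. -/
lemma exists_potential : ∃ H : ℝ × ℝ → ℝ, ∀ p : ℝ × ℝ, HasFDerivAt H
    ((polarKernel (p.1 ^ 2 + p.2 ^ 2) * p.2) • fst ℝ ℝ ℝ +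
      (gaussPdf p.2 * gaussCdf p.1 - polarKernel (p.1 ^ 2 + p.2 ^ 2) * p.1) • snd ℝ ℝ ℝ) p := by
  set ω : ℝ × ℝ → ℝ × ℝ →L[ℝ] ℝ := fun p =>
    (polarKernel (p.1 ^ 2 + p.2 ^ 2) * p.2) • fst ℝ ℝ ℝ +
      (gaussPdf p.2 * gaussCdf p.1 - polarKernel (p.1 ^ 2 + p.2 ^ 2) * p.1) • snd ℝ ℝ ℝ with hω
  have hpdf : Differentiable ℝ gaussPdf := by unfold gaussPdf; fun_prop
  have key : ∀ p : ℝ × ℝ, ∃ D : ℝ × ℝ →L[ℝ] ℝ × ℝ →L[ℝ] ℝ, HasFDerivAt ω D p ∧ ∀ x y, D x y = D y x := by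
    intro p
    have e1 : HasFDerivAt (fun q : ℝ × ℝ => q.1) (fst ℝ ℝ ℝ) p := hasFDerivAt_fst
    have e2 : HasFDerivAt (fun q : ℝ × ℝ => q.2) (snd ℝ ℝ ℝ) p := hasFDerivAt_snd
    have hs := (e1.pow 2).add (e2.pow 2)
    have hK := (differentiable_polarKernel (p.1 ^ 2 + p.2 ^ 2)).hasDerivAt.comp_hasFDerivAt p hs
    have h1 := (hK.mul e2).smul_const (fst ℝ ℝ ℝ)
    have hP := (hpdf p.2).hasDerivAt.comp_hasFDerivAt p e2
    have hC := (hasDerivAt_gaussCdf p.1).comp_hasFDerivAt p e1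
    have h2 := ((hP.mul hC).sub (hK.mul e1)).smul_const (snd ℝ ℝ ℝ)
    refine ⟨_, h1.add h2, fun x y => ?_⟩
    have hk := two_mul_deriv_polarKernel (p.1 ^ 2 + p.2 ^ 2)
    have hm := gaussPdf_mul p.1 p.2
    rw [← hk] at hm
    simp
    -- The antisymmetric part of the derivative is a multiple of `du ∧ dv`, and its coefficient
    -- vanishes because the two exterior derivatives agree.
    linear_combination (x.1 * y.2 - y.1 * x.2) * hm
  have := Convex.exists_forall_hasFDerivAt_of_fderiv_symmetric (s := univ) (ω := ω) convex_univ
    isOpen_univ (fun p _ => by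
      obtain ⟨D, hD, -⟩ := key p
      exact hD.differentiableAt.differentiableWithinAt) (fun p _ x y => by
      obtain ⟨D, hD, hs⟩ := key p
      rw [hD.fderiv]; exact hs x y)
  obtain ⟨H, hH⟩ := this
  exact ⟨H, fun p => hH p trivial⟩

/-- A choice of primitive as in `exists_potential`. -/
def potential : ℝ × ℝ → ℝ := exists_potential.choose

open ContinuousLinearMap in
lemma hasFDerivAt_potential (p : ℝ × ℝ) : HasFDerivAt potential
    ((polarKernel (p.1 ^ 2 + p.2 ^ 2) * p.2) • fst ℝ ℝ ℝ +
      (gaussPdf p.2 * gaussCdf p.1 - polarKernel (p.1 ^ 2 + p.2 ^ 2) * p.1) • snd ℝ ℝ ℝ) p :=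
  exists_potential.choose_spec p

lemma hasDerivAt_potential {a b : ℝ → ℝ} {a' b' t : ℝ} (ha : HasDerivAt a a' t)
    (hb : HasDerivAt b b' t) :
    HasDerivAt (fun t => potential (a t, b t))
      (gaussPdf (b t) * gaussCdf (a t) * b' -
        polarKernel (a t ^ 2 + b t ^ 2) * (a t * b' - b t * a')) t := by
  have := (hasFDerivAt_potential (a t, b t)).comp_hasDerivAt t (ha.prodMk hb)
  refine this.congr_deriv ?_
  simp
  ring

lemma continuous_potential : Continuous potential :=
  continuous_iff_continuousAt.2 fun p => (hasFDerivAt_potential p).continuousAt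

/-! ### Determinations of the polar angle -/

/-- `θ` is a smooth determination of the polar angle near `p`. -/
structure IsAngleAt (θ : ℝ × ℝ → ℝ) (p : ℝ × ℝ) : Prop where
  pos : 0 < p.1 ^ 2 + p.2 ^ 2
  hasFDerivAt : HasFDerivAt θ ((p.1 ^ 2 + p.2 ^ 2)⁻¹ •
    (p.1 • ContinuousLinearMap.snd ℝ ℝ ℝ - p.2 • ContinuousLinearMap.fst ℝ ℝ ℝ)) p
  cos_eq : √(p.1 ^ 2 + p.2 ^ 2) * cos (θ p) = p.1
  sin_eq : √(p.1 ^ 2 + p.2 ^ 2) * sin (θ p) = p.2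

lemma IsAngleAt.hasDerivAt {θ : ℝ × ℝ → ℝ} {a b : ℝ → ℝ} {a' b' t : ℝ}
    (h : IsAngleAt θ (a t, b t)) (ha : HasDerivAt a a' t) (hb : HasDerivAt b b' t) :
    HasDerivAt (fun t => θ (a t, b t)) ((a t * b' - b t * a') / (a t ^ 2 + b t ^ 2)) t := by
  have := h.hasFDerivAt.comp_hasDerivAt t (ha.prodMk hb)
  refine this.congr_deriv ?_
  simp
  ring

/-- The polar angle in `(-π, π)`. -/
def argRight (p : ℝ × ℝ) : ℝ := (Complex.equivRealProdCLM.symm p).arg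

/-- The polar angle in `(0, 2 π)`. -/
def argLeft (p : ℝ × ℝ) : ℝ := (Complex.equivRealProdCLM.symm (-p)).arg + π

lemma norm_symm (p : ℝ × ℝ) : ‖Complex.equivRealProdCLM.symm p‖ = √(p.1 ^ 2 + p.2 ^ 2) := by
  rw [Complex.norm_def, Complex.normSq_apply]
  simp [pow_two]

/-- The angle is the imaginary part of the complex logarithm, which is differentiable off the slit.
-/
lemma isAngleAt_argRight {p : ℝ × ℝ} (hp : 0 < p.1 ∨ p.2 ≠ 0) : IsAngleAt argRight p := by
  have hpos : 0 < p.1 ^ 2 + p.2 ^ 2 := by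
    rcases hp with h | h <;> positivity
  have hz : Complex.equivRealProdCLM.symm p ∈ Complex.slitPlane := by
    simpa [Complex.mem_slitPlane_iff] using hp
  refine ⟨hpos, ?_, ?_, ?_⟩
  · have h1 := (Complex.hasStrictFDerivAt_log_real hz).hasFDerivAt.comp p
      (Complex.equivRealProdCLM.symm.hasFDerivAt)
    have h2 := Complex.imCLM.hasFDerivAt.comp p h1
    have : argRight = Complex.imCLM ∘ Complex.log ∘ Complex.equivRealProdCLM.symm := by
      ext q; simp [argRight, Complex.log_im]
    rw [this]
    refine h2.congr_fderiv ?_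
    ext <;> simp [Complex.normSq_apply, Complex.inv_im, Complex.inv_re, Complex.mul_im] <;>
      field_simp
  · rw [← norm_symm]
    simp [argRight]
  · rw [← norm_symm]
    simp [argRight]

lemma isAngleAt_argLeft {p : ℝ × ℝ} (hp : p.1 < 0 ∨ p.2 ≠ 0) : IsAngleAt argLeft p := by
  have h := isAngleAt_argRight (p := -p) (by simpa using hp)
  have heq : argLeft = fun q => argRight (-q) + π := rfl
  refine ⟨by simpa using h.pos, ?_, ?_, ?_⟩
  · have := (h.hasFDerivAt.comp p (hasFDerivAt_id p).neg).add_const π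
    rw [heq]
    refine this.congr_fderiv ?_
    ext <;> simp
  · have := h.cos_eq
    simp only [heq, cos_add_pi, Prod.fst_neg, Prod.snd_neg, neg_sq] at *
    linarith
  · have := h.sin_eq
    simp only [heq, sin_add_pi, Prod.fst_neg, Prod.snd_neg, neg_sq] at *
    linarith

/-- The angle in `[0, π]` between the first axis and a point. -/
def axisAngle (p : ℝ × ℝ) : ℝ := arccos (p.1 / √(p.1 ^ 2 + p.2 ^ 2))

lemma argRight_of_nonneg {p : ℝ × ℝ} (h : 0 < p.1 ∨ p.2 ≠ 0) (h2 : 0 ≤ p.2) :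
    argRight p = axisAngle p := by
  have hz : Complex.equivRealProdCLM.symm p ≠ 0 := by
    rw [← norm_pos_iff, norm_symm]
    exact sqrt_pos.2 (isAngleAt_argRight h).pos
  have := Complex.arg_of_im_nonneg_of_ne_zero (z := Complex.equivRealProdCLM.symm p) (by simpa) hz
  rw [norm_symm] at this
  simpa [argRight, axisAngle] using this

lemma argRight_of_neg {p : ℝ × ℝ} (h2 : p.2 < 0) : argRight p = -axisAngle p := by
  have := Complex.arg_of_im_neg (z := Complex.equivRealProdCLM.symm p) (by simpa)
  rw [norm_symm] at this
  simpa [argRight, axisAngle] using this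

lemma axisAngle_neg (p : ℝ × ℝ) : axisAngle (-p) = π - axisAngle p := by
  simp [axisAngle, neg_div, arccos_neg]

lemma argLeft_of_nonneg {p : ℝ × ℝ} (h : p.1 < 0 ∨ p.2 ≠ 0) (h2 : 0 ≤ p.2) :
    argLeft p = axisAngle p := by
  change argRight (-p) + π = _
  rcases h2.eq_or_lt with h0 | h0
  · rw [argRight_of_nonneg (by simpa using h) (by simp [← h0]), axisAngle_neg]
    have hp : p.1 < 0 := by rcases h with h | h; exacts [h, absurd h0.symm h]
    have : axisAngle p = π := by
      rw [axisAngle, ← h0, arccos_eq_pi]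
      simp [sqrt_sq_eq_abs, abs_of_neg hp, div_neg, div_self hp.ne]
    rw [this]; ring
  · rw [argRight_of_neg (by simpa), axisAngle_neg]; ring

lemma argLeft_of_neg {p : ℝ × ℝ} (h2 : p.2 < 0) : argLeft p = 2 * π - axisAngle p := by
  change argRight (-p) + π = _
  rw [argRight_of_nonneg (Or.inr (by simpa using h2.ne)) (by simpa using h2.le), axisAngle_neg]
  ring

lemma axisAngle_eq_arctan {u v : ℝ} (hv : 0 < v) : axisAngle (u, v) = π / 2 - arctan (u / v) := by
  have h : √(1 + (u / v) ^ 2) = √(u ^ 2 + v ^ 2) / v := by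
    rw [eq_div_iff hv.ne', ← sqrt_sq hv.le, ← sqrt_mul (by positivity), sqrt_sq hv.le]
    congr 1; field_simp; ring
  rw [axisAngle, arccos_eq_pi_div_two_sub_arcsin, arctan_eq_arcsin, h]
  congr 2
  have : 0 < √(u ^ 2 + v ^ 2) := by positivity
  field_simp

/-! ### Green's theorem along a graph -/

lemma intervalIntegrable_of_bounded {Q : ℝ → ℝ} {C : ℝ} (hQ : Measurable Q)
    (hC : ∀ x, ‖Q x‖ ≤ C) (a b : ℝ) : IntervalIntegrable Q volume a b := by
  refine (intervalIntegrable_const (c := C)).mono_fun hQ.aestronglyMeasurable ?_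
  exact ae_of_all _ fun x => (hC x).trans (le_abs_self C)

/-- Green's theorem for the region under the graph `u = f v`, in terms of the polar angle. -/
lemma integral_graph {f : ℝ → ℝ} {θ : ℝ × ℝ → ℝ} {Q : ℝ → ℝ} {C s a b : ℝ} (hab : a ≤ b)
    (hQm : Measurable Q) (hC : ∀ x, ‖Q x‖ ≤ C) (hf : Continuous f)
    (hθ : ∀ v ∈ Icc a b, IsAngleAt θ (f v, v))
    (hf' : ∀ v ∈ Icc a b, v ≠ 0 → ∃ f', HasDerivAt f f' v ∧ Q (θ (f v, v) + s) * (f v - v * f') =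
      1 / (2 * π) * exp (-((f v ^ 2 + v ^ 2) / 2)) * (f v - v * f'))
    (hQ : ∀ v ∈ Icc a b, v ≠ 0 → ContinuousAt Q (θ (f v, v) + s)) :
    ∫ v in a..b, gaussPdf v * gaussCdf (f v) =
      potential (f b, b) - potential (f a, a) + (θ (f b, b) - θ (f a, a)) / (2 * π) -
        ∫ φ in (θ (f a, a) + s)..(θ (f b, b) + s), Q φ := by
  have hint := intervalIntegrable_of_bounded hQm hC
  have hM : Continuous fun v => gaussPdf v * gaussCdf (f v) :=
    continuous_gaussPdf.mul (continuous_gaussCdf.comp hf)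
  have hθc : ContinuousOn (fun v => θ (f v, v)) (Icc a b) := fun v hv =>
    ((hθ v hv).hasFDerivAt.continuousAt.comp (f := fun v => (f v, v))
      (by fun_prop)).continuousWithinAt
  have hT : Continuous fun x => ∫ φ in (0 : ℝ)..x, Q φ :=
    intervalIntegral.continuous_primitive hint 0
  have hP : Continuous fun v => potential (f v, v) := continuous_potential.comp (by fun_prop)
  rw [integral_eq_of_hasDerivAt_off_countable_of_le
    (fun v => potential (f v, v) + θ (f v, v) / (2 * π) - ∫ φ in (0 : ℝ)..(θ (f v, v) + s), Q φ)
    -- Height `0` is exempted because the branch has a kink there when `h = 0`; continuity is enough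
    -- at one point.
    _ hab (countable_singleton (0 : ℝ)) ?_ ?_ (hM.intervalIntegrable _ _)]
  · rw [← intervalIntegral.integral_interval_sub_left (hint 0 (θ (f b, b) + s))
      (hint 0 (θ (f a, a) + s))]
    ring
  · exact (hP.continuousOn.add (hθc.div_const _)).sub
      (hT.comp_continuousOn (hθc.add continuousOn_const))
  · rintro v ⟨hv, hv0⟩
    have hv' := Ioo_subset_Icc_self hv
    obtain ⟨f', hd, hq⟩ := hf' v hv' hv0
    have h1 := hasDerivAt_potential hd (hasDerivAt_id v)
    have h2 := (hθ v hv').hasDerivAt hd (hasDerivAt_id v)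
    have h3 : HasDerivAt (fun x => ∫ φ in (0 : ℝ)..x, Q φ) (Q (θ (f v, v) + s))
        (θ (f v, v) + s) := intervalIntegral.integral_hasDerivAt_right (hint _ _)
        hQm.stronglyMeasurable.stronglyMeasurableAtFilter (hQ v hv' hv0)
    have h4 := h3.comp v (h2.add_const s)
    refine ((h1.add (h2.div_const (2 * π))).sub h4).congr_deriv ?_
    have hpos : f v ^ 2 + v ^ 2 ≠ 0 := (hθ v hv').pos.ne'
    have hk := mul_polarKernel (f v ^ 2 + v ^ 2)
    have hk' : polarKernel (f v ^ 2 + v ^ 2) =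
        1 / (2 * π) * (1 - rexp (-((f v ^ 2 + v ^ 2) / 2))) / (f v ^ 2 + v ^ 2) := by
      rw [← hk]; field_simp
    -- The value of `Q` is only needed multiplied by `f - v f'`, the numerator of `dθ / dv`.
    have e : Q (θ (f v, v) + s) * ((f v * 1 - v * f') / (f v ^ 2 + v ^ 2)) =
        1 / (2 * π) * rexp (-((f v ^ 2 + v ^ 2) / 2)) * (f v - v * f') / (f v ^ 2 + v ^ 2) := by
      rw [← hq]; ring
    simp only [id] at *
    rw [e, hk']
    field_simp
    ring

/-- Along a line through the origin `u dv - v du` vanishes, so no angular term appears, even when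
the origin is crossed. -/
lemma integral_ray (k a b : ℝ) : ∫ v in a..b, gaussPdf v * gaussCdf (k * v) =
    potential (k * b, b) - potential (k * a, a) := by
  have hM : Continuous fun v => gaussPdf v * gaussCdf (k * v) :=
    continuous_gaussPdf.mul (continuous_gaussCdf.comp (by fun_prop))
  rw [intervalIntegral.integral_eq_sub_of_hasDerivAt (f := fun v => potential (k * v, v)) ?_
    (hM.intervalIntegrable _ _)]
  intro v _
  refine (hasDerivAt_potential ((hasDerivAt_id v).const_mul k) (hasDerivAt_id v)).congr_deriv ?_
  simp only [id]
  ring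

lemma norm_exp_le {x : ℝ} (hx : 0 ≤ x) : ‖1 / (2 * π) * exp (-x)‖ ≤ 1 / (2 * π) := by
  rw [norm_of_nonneg (by positivity)]
  have : exp (-x) ≤ 1 := by simpa using hx
  have h0 : 0 ≤ 1 / (2 * π) := by positivity
  nlinarith

lemma measurable_Psi (ϑ g k : ℝ) : Measurable (Psi ϑ g k) := by unfold Psi; fun_prop

lemma norm_Psi_le (ϑ g k φ : ℝ) : ‖Psi ϑ g k φ‖ ≤ 1 / (2 * π) := norm_exp_le (by positivity)

lemma measurable_Upsilon (ϑ lam h : ℝ) : Measurable (Upsilon ϑ lam h) := by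
  unfold Upsilon; fun_prop

lemma norm_Upsilon_le (ϑ lam h φ : ℝ) : ‖Upsilon ϑ lam h φ‖ ≤ 1 / (2 * π) :=
  norm_exp_le (by positivity)

lemma intervalIntegrable_Psi (ϑ g k a b : ℝ) : IntervalIntegrable (Psi ϑ g k) volume a b :=
  intervalIntegrable_of_bounded (measurable_Psi ϑ g k) (norm_Psi_le ϑ g k) a b

lemma intervalIntegrable_Upsilon (ϑ lam h a b : ℝ) :
    IntervalIntegrable (Upsilon ϑ lam h) volume a b :=
  intervalIntegrable_of_bounded (measurable_Upsilon ϑ lam h) (norm_Upsilon_le ϑ lam h) a b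

/-! ### Angular densities on the line and on the branch -/

/-- The line that bounds the domain, as a graph over the second axis. -/
def line (ϑ k g v : ℝ) : ℝ := k * v + (ϑ + g)

/-- The hyperbola branch that bounds the domain, as a graph over the second axis. -/
def branch (ϑ lam h v : ℝ) : ℝ := ϑ + √(lam * v ^ 2 + h)

lemma continuous_line (ϑ k g : ℝ) : Continuous (line ϑ k g) := by unfold line; fun_prop

lemma continuous_branch (ϑ lam h : ℝ) : Continuous (branch ϑ lam h) := by unfold branch; fun_prop

/-- Rotation by `phiK k` turns the line vertical: `√(1 + k ^ 2) * r * cos (θ + phiK k) = u - k * v =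
ϑ + g`. -/
lemma cos_add_phiK {ϑ g k v : ℝ} {θ : ℝ × ℝ → ℝ} (hθ : IsAngleAt θ (line ϑ k g v, v)) :
    (line ϑ k g v ^ 2 + v ^ 2) * ((1 + k ^ 2) * cos (θ (line ϑ k g v, v) + phiK k) ^ 2) =
      (ϑ + g) ^ 2 := by
  have h1 := hθ.cos_eq
  have h2 := hθ.sin_eq
  have hr := sq_sqrt hθ.pos.le
  simp only at h1 h2 hr
  set r := √(line ϑ k g v ^ 2 + v ^ 2)
  have hq : √(1 + k ^ 2) ^ 2 = 1 + k ^ 2 := sq_sqrt (by positivity)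
  have hq0 : √(1 + k ^ 2) ≠ 0 := by positivity
  have e : r * cos (θ (line ϑ k g v, v)) - r * sin (θ (line ϑ k g v, v)) * k = ϑ + g := by
    rw [h1, h2, line]; ring
  rw [cos_add, phiK, cos_arctan, sin_arctan, ← hr, ← e]
  generalize √(1 + k ^ 2) = q at *
  rw [← hq]
  field_simp

/-- Green's theorem along the line. -/
lemma integral_line {ϑ g k a b : ℝ} {θ : ℝ × ℝ → ℝ} (hab : a ≤ b)
    (hθ : ∀ v ∈ Icc a b, IsAngleAt θ (line ϑ k g v, v)) :
    ∫ v in a..b, gaussPdf v * gaussCdf (line ϑ k g v) =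
      potential (line ϑ k g b, b) - potential (line ϑ k g a, a) +
        (θ (line ϑ k g b, b) - θ (line ϑ k g a, a)) / (2 * π) -
        ∫ φ in (θ (line ϑ k g a, a) + phiK k)..(θ (line ϑ k g b, b) + phiK k), Psi ϑ g k φ := by
  refine integral_graph hab (measurable_Psi ϑ g k) (norm_Psi_le ϑ g k) (continuous_line ϑ k g) hθ
    (fun v hv _ => ⟨k, ?_, ?_⟩) (fun v hv _ => ?_)
  · exact (((hasDerivAt_id v).const_mul k).add_const (ϑ + g)).congr_deriv (mul_one k)
  · have e : line ϑ k g v - v * k = ϑ + g := by unfold line; ring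
    rw [e]
    -- If the line passes through the origin, the factor `f - v f'` is zero and nothing is asked of
    -- `Psi`.
    rcases eq_or_ne (ϑ + g) 0 with hc | hc
    · rw [hc]; ring
    have h := cos_add_phiK (hθ v hv)
    have hc2 : (ϑ + g) ^ 2 ≠ 0 := by positivity
    have hne : (1 + k ^ 2) * cos (θ (line ϑ k g v, v) + phiK k) ^ 2 ≠ 0 := by
      intro h0; rw [h0] at h; exact hc2 (by rw [← h]; ring)
    rw [Psi, ← h, mul_assoc 2 (1 + k ^ 2), mul_div_mul_right _ _ hne]
  · rcases eq_or_ne (ϑ + g) 0 with hc | hc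
    · have : Psi ϑ g k = fun _ => 1 / (2 * π) := by
        ext φ; simp [Psi, hc]
      rw [this]; exact continuousAt_const
    have h := cos_add_phiK (hθ v hv)
    have hne : cos (θ (line ϑ k g v, v) + phiK k) ≠ 0 := by
      intro h0; rw [h0] at h
      have hc2 : (ϑ + g) ^ 2 ≠ 0 := by positivity
      exact hc2 (by rw [← h]; ring)
    have hne' : 2 * (1 + k ^ 2) * cos (θ (line ϑ k g v, v) + phiK k) ^ 2 ≠ 0 := by positivity
    unfold Psi
    fun_prop (disch := assumption)

/-- The denominator in the definition of `Upsilon`. -/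
def tangentForm (ϑ lam h φ : ℝ) : ℝ :=
  ϑ * cos φ + √((h + lam * h - lam * ϑ ^ 2) * cos φ ^ 2 + lam * (ϑ ^ 2 - h))

/-- On the branch the radicand times `r ^ 2` is the perfect square `(ϑ * √(lam * v ^ 2 + h) + h) ^
2`. The absolute value left by the root is what forces the arcs to be treated by sign. -/
lemma sqrt_tangentForm {ϑ lam h v r c : ℝ} (hlam : 0 < lam) (hh : 0 ≤ h) (hr : 0 < r)
    (hr2 : r ^ 2 = branch ϑ lam h v ^ 2 + v ^ 2) (hc : r * c = branch ϑ lam h v) :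
    r * √((h + lam * h - lam * ϑ ^ 2) * c ^ 2 + lam * (ϑ ^ 2 - h)) =
      |ϑ * √(lam * v ^ 2 + h) + h| := by
  have hx := sq_sqrt (show 0 ≤ lam * v ^ 2 + h by positivity)
  rw [← abs_of_pos hr, ← sqrt_sq_eq_abs, ← sqrt_mul (by positivity), ← sqrt_sq_eq_abs]
  congr 1
  have e1 : r ^ 2 * ((h + lam * h - lam * ϑ ^ 2) * c ^ 2 + lam * (ϑ ^ 2 - h)) =
    (h + lam * h - lam * ϑ ^ 2) * (r * c) ^ 2 + lam * (ϑ ^ 2 - h) * r ^ 2 := by ring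
  rw [e1, hc, hr2]
  unfold branch
  linear_combination (-(ϑ ^ 2 - h)) * hx

/-- `Upsilon` sees only the square of `tangentForm`, so either sign of `r * tangentForm = ±(ϑ ^ 2 -
h)` will do; `ϑ ^ 2 ≠ h` keeps the denominator away from zero. -/
lemma Upsilon_of_sq {ϑ lam h φ r2 : ℝ} (hne : ϑ ^ 2 ≠ h)
    (hD : r2 * tangentForm ϑ lam h φ ^ 2 = (ϑ ^ 2 - h) ^ 2) :
    Upsilon ϑ lam h φ = 1 / (2 * π) * exp (-(r2 / 2)) ∧
      ContinuousAt (Upsilon ϑ lam h) φ := by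
  have h0 : (ϑ ^ 2 - h) ^ 2 ≠ 0 := by
    have : ϑ ^ 2 - h ≠ 0 := sub_ne_zero.2 hne
    positivity
  have hT : tangentForm ϑ lam h φ ≠ 0 := by
    intro hT; rw [hT] at hD; exact h0 (by rw [← hD]; ring)
  constructor
  · rw [Upsilon, ← tangentForm, ← hD, mul_div_mul_right _ _ (by positivity)]
  · have hT' : 2 * (ϑ * cos φ +
      √((h + lam * h - lam * ϑ ^ 2) * cos φ ^ 2 + lam * (ϑ ^ 2 - h))) ^ 2 ≠ 0 := by
      have := hT
      unfold tangentForm at this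
      positivity
    unfold Upsilon
    fun_prop (disch := assumption)

lemma hasDerivAt_branch {ϑ lam h v : ℝ} (hlam : 0 < lam) (hh : 0 ≤ h) (hv : v ≠ 0) :
    HasDerivAt (branch ϑ lam h) (lam * v / √(lam * v ^ 2 + h)) v := by
  have hpos : 0 < lam * v ^ 2 + h := by positivity
  have := (((((hasDerivAt_id v).pow 2).const_mul lam).add_const h).sqrt hpos.ne').const_add ϑ
  refine this.congr_deriv ?_
  simp
  field_simp

/-- Green's theorem along a part of the hyperbola seen from the origin with a constant
orientation. -/
lemma integral_branch {ϑ lam h a b s : ℝ} {θ : ℝ × ℝ → ℝ} (hlam : 0 < lam) (hh : 0 ≤ h)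
    (hne : ϑ ^ 2 ≠ h) (hab : a ≤ b)
    (hθ : ∀ v ∈ Icc a b, IsAngleAt θ (branch ϑ lam h v, v))
    (hs : (s = π ∧ ∀ v ∈ Icc a b, 0 ≤ ϑ * √(lam * v ^ 2 + h) + h) ∨
      (s = 0 ∧ ∀ v ∈ Icc a b, ϑ * √(lam * v ^ 2 + h) + h ≤ 0)) :
    ∫ v in a..b, gaussPdf v * gaussCdf (branch ϑ lam h v) =
      potential (branch ϑ lam h b, b) - potential (branch ϑ lam h a, a) +
        (θ (branch ϑ lam h b, b) - θ (branch ϑ lam h a, a)) / (2 * π) -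
        ∫ φ in (θ (branch ϑ lam h a, a) + s)..(θ (branch ϑ lam h b, b) + s),
          Upsilon ϑ lam h φ := by
  have key : ∀ v ∈ Icc a b, (branch ϑ lam h v ^ 2 + v ^ 2) *
      tangentForm ϑ lam h (θ (branch ϑ lam h v, v) + s) ^ 2 = (ϑ ^ 2 - h) ^ 2 := by
    intro v hv
    have hr : 0 < √(branch ϑ lam h v ^ 2 + v ^ 2) := sqrt_pos.2 (hθ v hv).pos
    have hr2 := sq_sqrt (hθ v hv).pos.le
    have hc := (hθ v hv).cos_eq
    have hS := sqrt_tangentForm hlam hh hr hr2 hc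
    simp only at hc hr2 hS
    rw [← hr2, ← mul_pow, tangentForm, mul_add]
    have hb : branch ϑ lam h v = ϑ + √(lam * v ^ 2 + h) := rfl
    rw [hb] at hc
    -- The shift by `π` flips the sign of `ϑ * cos`, so that in both cases the terms `ϑ * √(lam * v
    -- ^ 2 + h)` cancel and `±(ϑ ^ 2 - h)` is left.
    rcases hs with ⟨rfl, hs⟩ | ⟨rfl, hs⟩
    · rw [abs_of_nonneg (hs v hv)] at hS
      rw [cos_add_pi, neg_sq, hS]
      rw [show √(branch ϑ lam h v ^ 2 + v ^ 2) * (ϑ * -cos (θ (branch ϑ lam h v, v))) =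
        -ϑ * (√(branch ϑ lam h v ^ 2 + v ^ 2) * cos (θ (branch ϑ lam h v, v))) by ring]
      rw [hb, hc]; ring
    · rw [abs_of_nonpos (hs v hv)] at hS
      rw [add_zero, hS]
      rw [show √(branch ϑ lam h v ^ 2 + v ^ 2) * (ϑ * cos (θ (branch ϑ lam h v, v))) =
        ϑ * (√(branch ϑ lam h v ^ 2 + v ^ 2) * cos (θ (branch ϑ lam h v, v))) by ring]
      rw [hb, hc]; ring
  refine integral_graph hab (measurable_Upsilon ϑ lam h) (norm_Upsilon_le ϑ lam h)
    (continuous_branch ϑ lam h) hθ (fun v hv hv0 => ⟨_, hasDerivAt_branch hlam hh hv0, ?_⟩)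
    (fun v hv _ => (Upsilon_of_sq hne (key v hv)).2)
  rw [(Upsilon_of_sq hne (key v hv)).1]

lemma integral_line_right {ϑ g k a b : ℝ} (hab : a ≤ b) (hc : 0 < ϑ + g ∨ 0 < a) :
    ∫ v in a..b, gaussPdf v * gaussCdf (line ϑ k g v) =
      potential (line ϑ k g b, b) - potential (line ϑ k g a, a) +
        (argRight (line ϑ k g b, b) - argRight (line ϑ k g a, a)) / (2 * π) -
        ∫ φ in (argRight (line ϑ k g a, a) + phiK k)..(argRight (line ϑ k g b, b) + phiK k),
          Psi ϑ g k φ := by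
  refine integral_line hab fun v hv => isAngleAt_argRight ?_
  rcases hc with hc | hc
  · rcases eq_or_ne v 0 with rfl | h0
    · left; simpa [line] using hc
    · exact Or.inr h0
  · exact Or.inr (hc.trans_le hv.1).ne'

lemma integral_line_left {ϑ g k a b : ℝ} (hab : a ≤ b) (hc : ϑ + g < 0) :
    ∫ v in a..b, gaussPdf v * gaussCdf (line ϑ k g v) =
      potential (line ϑ k g b, b) - potential (line ϑ k g a, a) +
        (argLeft (line ϑ k g b, b) - argLeft (line ϑ k g a, a)) / (2 * π) -
        ∫ φ in (argLeft (line ϑ k g a, a) + phiK k)..(argLeft (line ϑ k g b, b) + phiK k),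
          Psi ϑ g k φ := by
  refine integral_line hab fun v hv => isAngleAt_argLeft ?_
  rcases eq_or_ne v 0 with rfl | h0
  · left; simpa [line] using hc
  · exact Or.inr h0

/-- Here `Psi` is the constant `1 / (2 * π)`, so the two angular terms cancel for arbitrary `α` and
`β`. Hence a line through the origin fits the same formula as other lines, although no angle is
defined there. -/
lemma integral_line_of_eq_zero {ϑ g k : ℝ} (hc : ϑ + g = 0) (a b α β : ℝ) :
    ∫ v in a..b, gaussPdf v * gaussCdf (line ϑ k g v) =
      potential (line ϑ k g b, b) - potential (line ϑ k g a, a) +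
        (β - α) / (2 * π) - ∫ φ in (α + phiK k)..(β + phiK k), Psi ϑ g k φ := by
  have h1 : Psi ϑ g k = fun _ => 1 / (2 * π) := by
    ext φ; simp [Psi, hc]
  have h2 : line ϑ k g = fun v => k * v := by
    ext v; simp [line, hc]
  rw [h1, h2, integral_ray, intervalIntegral.integral_const, smul_eq_mul]
  ring

/-! ### Points where the tangent to the branch passes through the origin -/

/-- The numerator of the abscissa at which the tangent line to the branch at height `v` meets the
first axis. -/
def tangentNum (ϑ lam h v : ℝ) : ℝ := ϑ * √(lam * v ^ 2 + h) + h

section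

variable {ϑ lam h : ℝ}

lemma sqrt_le_sqrt_abs (hlam : 0 < lam) {v w : ℝ} (hvw : |v| ≤ |w|) :
    √(lam * v ^ 2 + h) ≤ √(lam * w ^ 2 + h) :=
  sqrt_le_sqrt (by have := sq_le_sq.2 hvw; gcongr)

lemma tangentNum_anti (hlam : 0 < lam) (hϑ : ϑ ≤ 0) {v w : ℝ} (hvw : |v| ≤ |w|) :
    tangentNum ϑ lam h w ≤ tangentNum ϑ lam h v := by
  have := mul_le_mul_of_nonpos_left (sqrt_le_sqrt_abs (h := h) hlam hvw) hϑ
  unfold tangentNum; linarith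

/-- For `ϑ ≤ 0` the numerator decreases in `|v|`, otherwise it is never negative; a test at the
point farthest from the axis therefore settles the whole arc. -/
lemma tangentNum_nonneg (hlam : 0 < lam) (hh : 0 ≤ h) {v w : ℝ} (hvw : |v| ≤ |w|)
    (hw : 0 ≤ tangentNum ϑ lam h w) : 0 ≤ tangentNum ϑ lam h v := by
  rcases le_total ϑ 0 with hϑ | hϑ
  · exact hw.trans (tangentNum_anti hlam hϑ hvw)
  · unfold tangentNum; positivity

lemma tangentNum_nonpos_of_neg (hlam : 0 < lam) (hh : 0 ≤ h) (hϑ : ϑ + √h < 0) (v : ℝ) :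
    tangentNum ϑ lam h v ≤ 0 := by
  have h0 := sqrt_nonneg h
  refine (tangentNum_anti hlam (by linarith) (v := 0) (by simp)).trans ?_
  have : h = √h * √h := (mul_self_sqrt hh).symm
  simp only [tangentNum, ne_eq, OfNat.ofNat_ne_zero, not_false_eq_true, zero_pow, mul_zero,
    zero_add]
  nlinarith

/-- The positive height of the points of the branch whose tangent line passes through the
origin. -/
def tangencyHeight (ϑ lam h : ℝ) : ℝ := √(((h / ϑ) ^ 2 - h) / lam)

/-- Tangency means `√(lam * v ^ 2 + h) = -(h / ϑ)`, and a solution off the axis needs the right side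
to exceed `√h`. -/
lemma tangency_aux (hϑ : ϑ < 0) (hlt : ϑ ^ 2 < h) : 0 < (h / ϑ) ^ 2 - h := by
  have h0 : 0 < h := (sq_nonneg ϑ).trans_lt hlt
  have h2 : 0 < ϑ ^ 2 := by have := hϑ.ne; positivity
  rw [div_pow, sub_pos, lt_div_iff₀ h2]
  nlinarith

lemma tangencyHeight_pos (hlam : 0 < lam) (hϑ : ϑ < 0) (hlt : ϑ ^ 2 < h) :
    0 < tangencyHeight ϑ lam h := sqrt_pos.2 (div_pos (tangency_aux hϑ hlt) hlam)

lemma sqrt_tangencyHeight (hlam : 0 < lam) (hϑ : ϑ < 0) (hlt : ϑ ^ 2 < h) :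
    √(lam * tangencyHeight ϑ lam h ^ 2 + h) = -(h / ϑ) := by
  have h0 : 0 < h := (sq_nonneg ϑ).trans_lt hlt
  have hneg : h / ϑ < 0 := div_neg_of_pos_of_neg h0 hϑ
  rw [tangencyHeight, sq_sqrt (div_pos (tangency_aux hϑ hlt) hlam).le, mul_div_cancel₀ _ hlam.ne',
    sub_add_cancel, sqrt_sq_eq_abs, abs_of_neg hneg]

lemma tangentNum_tangencyHeight (hlam : 0 < lam) (hϑ : ϑ < 0) (hlt : ϑ ^ 2 < h) :
    tangentNum ϑ lam h (tangencyHeight ϑ lam h) = 0 := by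
  rw [tangentNum, sqrt_tangencyHeight hlam hϑ hlt]
  have := hϑ.ne
  field_simp
  ring

lemma tangentNum_nonneg_iff (hlam : 0 < lam) (hϑ : ϑ < 0) (hlt : ϑ ^ 2 < h) {v : ℝ} :
    0 ≤ tangentNum ϑ lam h v ↔ |v| ≤ tangencyHeight ϑ lam h := by
  have hT := tangencyHeight_pos hlam hϑ hlt
  have h0 : 0 < h := (sq_nonneg ϑ).trans_lt hlt
  constructor
  · intro hv
    by_contra! hlt'
    have : √(lam * tangencyHeight ϑ lam h ^ 2 + h) < √(lam * v ^ 2 + h) := by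
      apply sqrt_lt_sqrt (by positivity)
      have : tangencyHeight ϑ lam h ^ 2 < v ^ 2 := sq_lt_sq.2 (by rwa [abs_of_pos hT])
      nlinarith
    have e := tangentNum_tangencyHeight hlam hϑ hlt
    unfold tangentNum at e hv
    nlinarith
  · intro hv
    rw [← tangentNum_tangencyHeight hlam hϑ hlt]
    exact tangentNum_anti hlam hϑ.le (by rwa [abs_of_pos hT])

lemma tangentNum_nonpos_of_le (hlam : 0 < lam) (hϑ : ϑ < 0) (hlt : ϑ ^ 2 < h) {v : ℝ}
    (hv : tangencyHeight ϑ lam h ≤ |v|) : tangentNum ϑ lam h v ≤ 0 := by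
  rw [← tangentNum_tangencyHeight hlam hϑ hlt]
  exact tangentNum_anti hlam hϑ.le (by rwa [abs_of_pos (tangencyHeight_pos hlam hϑ hlt)])

lemma le_abs_of_tangentNum_nonpos (hlam : 0 < lam) (hϑ : ϑ < 0) (hlt : ϑ ^ 2 < h) {v : ℝ}
    (hv : tangentNum ϑ lam h v ≤ 0) : tangencyHeight ϑ lam h ≤ |v| := by
  by_contra! hlt'
  have hT := tangencyHeight_pos hlam hϑ hlt
  have h0 : 0 < h := (sq_nonneg ϑ).trans_lt hlt
  have : √(lam * v ^ 2 + h) < √(lam * tangencyHeight ϑ lam h ^ 2 + h) := by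
    apply sqrt_lt_sqrt (by positivity)
    have : v ^ 2 < tangencyHeight ϑ lam h ^ 2 := sq_lt_sq.2 (by rwa [abs_of_pos hT])
    nlinarith
  have e := tangentNum_tangencyHeight hlam hϑ hlt
  unfold tangentNum at e hv
  nlinarith

lemma branch_pos (hlam : 0 < lam) (hR : 0 < ϑ + √h) (v : ℝ) : 0 < branch ϑ lam h v := by
  have : √h ≤ √(lam * v ^ 2 + h) := sqrt_le_sqrt (by nlinarith [sq_nonneg v])
  unfold branch; linarith

lemma axisAngle_tangencyHeight (hlam : 0 < lam) (hϑ : ϑ < 0) (hlt : ϑ ^ 2 < h) :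
    axisAngle (branch ϑ lam h (tangencyHeight ϑ lam h), tangencyHeight ϑ lam h) =
      phiM ϑ lam h := by
  have hT := tangencyHeight_pos hlam hϑ hlt
  have h0 : 0 < h := (sq_nonneg ϑ).trans_lt hlt
  have hb : branch ϑ lam h (tangencyHeight ϑ lam h) = (ϑ ^ 2 - h) / ϑ := by
    rw [branch, sqrt_tangencyHeight hlam hϑ hlt]
    have := hϑ.ne
    field_simp
    ring
  have hbp : 0 < (ϑ ^ 2 - h) / ϑ := div_pos_of_neg_of_neg (by linarith) hϑ
  rw [axisAngle_eq_arctan hT, ← arctan_inv_of_pos (by rw [hb]; positivity), phiM, inv_div, hb]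
  congr 1
  rw [← sqrt_sq (div_pos hT hbp).le]
  congr 1
  rw [div_pow, tangencyHeight, sq_sqrt (div_pos (tangency_aux hϑ hlt) hlam).le,
    abs_of_neg (by linarith)]
  have h1 := hϑ.ne
  have h2 : ϑ ^ 2 - h ≠ 0 := by linarith
  have h3 : -(ϑ ^ 2 - h) ≠ 0 := by linarith
  rw [div_eq_div_iff (by positivity) (by positivity)]
  field_simp
  ring

lemma branch_neg (v : ℝ) : branch ϑ lam h (-v) = branch ϑ lam h v := by simp [branch]

lemma argRight_tangencyHeight (hlam : 0 < lam) (hϑ : ϑ < 0) (hlt : ϑ ^ 2 < h) :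
    argRight (branch ϑ lam h (tangencyHeight ϑ lam h), tangencyHeight ϑ lam h) =
      phiM ϑ lam h := by
  have hT := tangencyHeight_pos hlam hϑ hlt
  rw [← axisAngle_tangencyHeight hlam hϑ hlt]
  exact argRight_of_nonneg (Or.inr hT.ne') hT.le

lemma argRight_neg_tangencyHeight (hlam : 0 < lam) (hϑ : ϑ < 0) (hlt : ϑ ^ 2 < h) :
    argRight (branch ϑ lam h (-tangencyHeight ϑ lam h), -tangencyHeight ϑ lam h) =
      -phiM ϑ lam h := by
  have hT := tangencyHeight_pos hlam hϑ hlt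
  rw [← axisAngle_tangencyHeight hlam hϑ hlt, argRight_of_neg (by simpa), branch_neg]
  simp [axisAngle]

lemma integral_branch_right_nonneg {a b : ℝ} (hlam : 0 < lam) (hh : 0 ≤ h)
    (hne : ϑ ^ 2 ≠ h) (hab : a ≤ b) (hR : 0 < ϑ + √h)
    (ht : ∀ v ∈ Icc a b, 0 ≤ tangentNum ϑ lam h v) :
    ∫ v in a..b, gaussPdf v * gaussCdf (branch ϑ lam h v) =
      potential (branch ϑ lam h b, b) - potential (branch ϑ lam h a, a) +
        (argRight (branch ϑ lam h b, b) - argRight (branch ϑ lam h a, a)) / (2 * π) -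
        ∫ φ in (argRight (branch ϑ lam h a, a) + π)..(argRight (branch ϑ lam h b, b) + π),
          Upsilon ϑ lam h φ :=
  integral_branch hlam hh hne hab
    (fun v _ => isAngleAt_argRight (Or.inl (branch_pos hlam hR v))) (Or.inl ⟨rfl, ht⟩)

lemma integral_branch_right_nonpos {a b : ℝ} (hlam : 0 < lam) (hh : 0 ≤ h)
    (hne : ϑ ^ 2 ≠ h) (hab : a ≤ b) (hR : 0 < ϑ + √h)
    (ht : ∀ v ∈ Icc a b, tangentNum ϑ lam h v ≤ 0) :
    ∫ v in a..b, gaussPdf v * gaussCdf (branch ϑ lam h v) =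
      potential (branch ϑ lam h b, b) - potential (branch ϑ lam h a, a) +
        (argRight (branch ϑ lam h b, b) - argRight (branch ϑ lam h a, a)) / (2 * π) -
        ∫ φ in (argRight (branch ϑ lam h a, a))..(argRight (branch ϑ lam h b, b)),
          Upsilon ϑ lam h φ := by
  simpa using integral_branch hlam hh hne hab
    (fun v _ => isAngleAt_argRight (Or.inl (branch_pos hlam hR v))) (Or.inr ⟨rfl, ht⟩)

lemma integral_branch_left {a b : ℝ} (hlam : 0 < lam) (hh : 0 ≤ h)
    (hne : ϑ ^ 2 ≠ h) (hab : a ≤ b) (hL : ϑ + √h < 0) :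
    ∫ v in a..b, gaussPdf v * gaussCdf (branch ϑ lam h v) =
      potential (branch ϑ lam h b, b) - potential (branch ϑ lam h a, a) +
        (argLeft (branch ϑ lam h b, b) - argLeft (branch ϑ lam h a, a)) / (2 * π) -
        ∫ φ in (argLeft (branch ϑ lam h a, a))..(argLeft (branch ϑ lam h b, b)),
          Upsilon ϑ lam h φ := by
  simpa using integral_branch (s := 0) hlam hh hne hab
    (fun v _ => isAngleAt_argLeft (by
      rcases eq_or_ne v 0 with rfl | h0
      · left; simpa [branch] using hL
      · exact Or.inr h0))
    (Or.inr ⟨rfl, fun v _ => tangentNum_nonpos_of_neg hlam hh hL v⟩)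

lemma intervalIntegrable_gauss_branch (a b : ℝ) :
    IntervalIntegrable (fun v => gaussPdf v * gaussCdf (branch ϑ lam h v)) volume a b :=
  (continuous_gaussPdf.mul (continuous_gaussCdf.comp
    (continuous_branch ϑ lam h))).intervalIntegrable _ _

lemma intervalIntegrable_gauss_line (k g a b : ℝ) :
    IntervalIntegrable (fun v => gaussPdf v * gaussCdf (line ϑ k g v)) volume a b :=
  (continuous_gaussPdf.mul (continuous_gaussCdf.comp
    (continuous_line ϑ k g))).intervalIntegrable _ _

lemma add_sqrt_pos_of_sq_lt (hlt : ϑ ^ 2 < h) : 0 < ϑ + √h := by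
  have := lt_sqrt_of_sq_lt (x := |ϑ|) (by rwa [sq_abs])
  linarith [neg_abs_le ϑ]

lemma integral_branch_right_tangent {a b : ℝ} (hlam : 0 < lam) (hϑ : ϑ < 0) (hlt : ϑ ^ 2 < h)
    (ha : |a| ≤ tangencyHeight ϑ lam h) (hb : tangencyHeight ϑ lam h ≤ b) :
    ∫ v in a..b, gaussPdf v * gaussCdf (branch ϑ lam h v) =
      potential (branch ϑ lam h b, b) - potential (branch ϑ lam h a, a) +
        (argRight (branch ϑ lam h b, b) - argRight (branch ϑ lam h a, a)) / (2 * π) -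
        ((∫ φ in (argRight (branch ϑ lam h a, a) + π)..(phiM ϑ lam h + π), Upsilon ϑ lam h φ) +
          ∫ φ in (phiM ϑ lam h)..(argRight (branch ϑ lam h b, b)), Upsilon ϑ lam h φ) := by
  have h0 : 0 < h := (sq_nonneg ϑ).trans_lt hlt
  have hT := tangencyHeight_pos hlam hϑ hlt
  have hR := add_sqrt_pos_of_sq_lt hlt
  rw [← intervalIntegral.integral_add_adjacent_intervals (intervalIntegrable_gauss_branch a _)
    (intervalIntegrable_gauss_branch (tangencyHeight ϑ lam h) b),
    integral_branch_right_nonneg hlam h0.le hlt.ne ((le_abs_self a).trans ha) hR ?_,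
    integral_branch_right_nonpos hlam h0.le hlt.ne hb hR ?_,
    argRight_tangencyHeight hlam hϑ hlt]
  · ring
  · intro v hv
    exact tangentNum_nonpos_of_le hlam hϑ hlt (hv.1.trans (le_abs_self v))
  · intro v hv
    rw [tangentNum_nonneg_iff hlam hϑ hlt, abs_le]
    exact ⟨(abs_le.1 ha).1.trans hv.1, hv.2⟩

lemma integral_branch_right_tangents {a b : ℝ} (hlam : 0 < lam) (hϑ : ϑ < 0) (hlt : ϑ ^ 2 < h)
    (ha : a ≤ -tangencyHeight ϑ lam h) (hb : tangencyHeight ϑ lam h ≤ b) :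
    ∫ v in a..b, gaussPdf v * gaussCdf (branch ϑ lam h v) =
      potential (branch ϑ lam h b, b) - potential (branch ϑ lam h a, a) +
        (argRight (branch ϑ lam h b, b) - argRight (branch ϑ lam h a, a)) / (2 * π) -
        ((∫ φ in (argRight (branch ϑ lam h a, a))..(-phiM ϑ lam h), Upsilon ϑ lam h φ) +
          (∫ φ in (-phiM ϑ lam h + π)..(phiM ϑ lam h + π), Upsilon ϑ lam h φ) +
          ∫ φ in (phiM ϑ lam h)..(argRight (branch ϑ lam h b, b)), Upsilon ϑ lam h φ) := by
  have h0 : 0 < h := (sq_nonneg ϑ).trans_lt hlt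
  have hT := tangencyHeight_pos hlam hϑ hlt
  have hR := add_sqrt_pos_of_sq_lt hlt
  rw [← intervalIntegral.integral_add_adjacent_intervals (intervalIntegrable_gauss_branch a _)
    (intervalIntegrable_gauss_branch (-tangencyHeight ϑ lam h) b),
    integral_branch_right_nonpos hlam h0.le hlt.ne ha hR ?_,
    integral_branch_right_tangent hlam hϑ hlt (by rw [abs_neg, abs_of_pos hT]) hb,
    argRight_neg_tangencyHeight hlam hϑ hlt]
  · ring
  · intro v hv
    refine tangentNum_nonpos_of_le hlam hϑ hlt ?_
    rw [← abs_neg]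
    exact (le_neg.1 hv.2).trans (le_abs_self _)

end

/-! ### The probability as an integral over heights -/

lemma integrable_gaussPdf : Integrable gaussPdf := by
  rw [gaussPdf_eq]; exact integrable_gaussianPDFReal 0 1

lemma abs_gaussCdf_le (u : ℝ) : |gaussCdf u| ≤ 1 := by
  have h1 : ∫ x, gaussPdf x = 1 := by
    rw [gaussPdf_eq]; exact integral_gaussianPDFReal_eq_one 0 one_ne_zero
  rw [← h1, gaussCdf, ← norm_eq_abs]
  refine intervalIntegral.norm_integral_le_integral_norm_uIoc.trans ?_
  simp_rw [norm_of_nonneg (gaussPdf_nonneg _)]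
  exact setIntegral_le_integral integrable_gaussPdf (ae_of_all _ gaussPdf_nonneg)

lemma integrable_gaussPdf_mul_gaussCdf {f : ℝ → ℝ} (hf : Continuous f) :
    Integrable fun v => gaussPdf v * gaussCdf (f v) :=
  integrable_gaussPdf.mul_bdd (c := 1) (continuous_gaussCdf.comp hf).aestronglyMeasurable
    (ae_of_all _ fun _ => abs_gaussCdf_le _)

lemma gaussianReal_real_Icc {a b : ℝ} (hab : a ≤ b) :
    (gaussianReal 0 1).real (Icc a b) = gaussCdf b - gaussCdf a := by
  rw [measureReal_def, gaussianReal_apply_eq_integral 0 one_ne_zero, ← gaussPdf_eq,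
    ENNReal.toReal_ofReal (setIntegral_nonneg measurableSet_Icc fun x _ => gaussPdf_nonneg x),
    integral_Icc_eq_integral_Ioc, ← intervalIntegral.integral_of_le hab, gaussCdf, gaussCdf,
    intervalIntegral.integral_interval_sub_left] <;>
  exact continuous_gaussPdf.intervalIntegrable _ _

lemma mem_domainD {ϑ lam h k g : ℝ} {u v : ℝ} :
    (u, v) ∈ domainD ϑ lam h k g ↔ u ∈ Icc (branch ϑ lam h v) (line ϑ k g v) := by
  simp only [domainD, mem_ofPred_eq, mem_Icc, branch, line]
  constructor <;> rintro ⟨h1, h2⟩ <;> constructor <;> linarith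

lemma measurableSet_domainD (ϑ lam h k g : ℝ) : MeasurableSet (domainD ϑ lam h k g) := by
  exact (measurableSet_le (f := fun p : ℝ × ℝ => √(lam * p.2 ^ 2 + h)) (g := fun p => p.1 - ϑ)
    (by fun_prop) (by fun_prop)).inter (measurableSet_le (f := fun p : ℝ × ℝ => p.1 - ϑ)
    (g := fun p => k * p.2 + g) (by fun_prop) (by fun_prop))

lemma measureReal_domainD (ϑ lam h k g : ℝ) :
    ((gaussianReal 0 1).prod (gaussianReal 0 1)).real (domainD ϑ lam h k g) =
      ∫ v in {v | branch ϑ lam h v ≤ line ϑ k g v},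
        (gaussPdf v * gaussCdf (line ϑ k g v) - gaussPdf v * gaussCdf (branch ϑ lam h v)) := by
  have hm := measurableSet_domainD ϑ lam h k g
  have hS : MeasurableSet {v | branch ϑ lam h v ≤ line ϑ k g v} :=
    measurableSet_le (continuous_branch ϑ lam h).measurable (continuous_line ϑ k g).measurable
  rw [measureReal_def, Measure.prod_apply_symm hm, ← integral_toReal
    (measurable_measure_prodMk_right hm).aemeasurable (ae_of_all _ fun _ => measure_lt_top _ _),
    integral_gaussianReal_eq_integral_smul one_ne_zero, ← integral_indicator hS]
  refine integral_congr_ae (ae_of_all _ fun v => ?_)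
  have : (fun u => (u, v)) ⁻¹' domainD ϑ lam h k g = Icc (branch ϑ lam h v) (line ϑ k g v) := by
    ext u; exact mem_domainD
  simp only [this, smul_eq_mul, ← gaussPdf_eq, ← measureReal_def]
  by_cases hv : branch ϑ lam h v ≤ line ϑ k g v
  · rw [indicator_of_mem (by exact hv), gaussianReal_real_Icc hv, mul_sub]
  · rw [indicator_of_notMem (by exact hv), Icc_eq_empty hv]
    simp

lemma prob_eq {Ω : Type*} [MeasurableSpace Ω] {P : Measure Ω} [IsProbabilityMeasure P]
    {U V : Ω → ℝ} (hU : HasLaw U (gaussianReal 0 1) P) (hV : HasLaw V (gaussianReal 0 1) P)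
    (hUV : IndepFun U V P) {D : Set (ℝ × ℝ)} (hD : MeasurableSet D) :
    P.real {ω | (U ω, V ω) ∈ D} = ((gaussianReal 0 1).prod (gaussianReal 0 1)).real D := by
  have h := (indepFun_iff_map_prod_eq_prod_map_map hU.aemeasurable hV.aemeasurable).1 hUV
  rw [hU.map_eq, hV.map_eq] at h
  rw [← h, map_measureReal_apply_of_aemeasurable (hU.aemeasurable.prodMk hV.aemeasurable) hD]
  rfl

/-! ### Closing the contour, at `B` or at infinity -/

/-- The angular contribution of a horizontal segment at large height vanishes. -/
lemma abs_sub_potential_le {b : ℝ} (hb : 1 ≤ b) (x y : ℝ) :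
    |(potential (x, b) - potential (y, b)) +
      (argRight (x, b) - argRight (y, b)) / (2 * π)| ≤ exp (-(b ^ 2 / 2)) * |x - y| := by
  have hb0 : 0 < b := by linarith
  -- Since `dv = 0` on the segment, only `exp (-r ^ 2 / 2) dθ / (2 π)` remains.
  have hd : ∀ u : ℝ, HasDerivAt (fun u => potential (u, b) + argRight (u, b) / (2 * π))
      (-(b * exp (-((u ^ 2 + b ^ 2) / 2)) / (2 * π * (u ^ 2 + b ^ 2)))) u := by
    intro u
    have hA : IsAngleAt argRight (id u, (fun _ => b) u) := isAngleAt_argRight (Or.inr hb0.ne')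
    have h1 := hasDerivAt_potential (hasDerivAt_id u) (hasDerivAt_const u b)
    have h2 := hA.hasDerivAt (hasDerivAt_id u) (hasDerivAt_const u b)
    refine (h1.add (h2.div_const (2 * π))).congr_deriv ?_
    have hpos : u ^ 2 + b ^ 2 ≠ 0 := by positivity
    have hk : polarKernel (u ^ 2 + b ^ 2) =
        1 / (2 * π) * (1 - rexp (-((u ^ 2 + b ^ 2) / 2))) / (u ^ 2 + b ^ 2) := by
      rw [← mul_polarKernel]; field_simp
    simp only [id]
    rw [hk]
    field_simp
    ring
  have := convex_univ.norm_image_sub_le_of_norm_hasDerivWithin_le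
    (C := exp (-(b ^ 2 / 2))) (fun u _ => (hd u).hasDerivWithinAt) (fun u _ => ?_)
    (mem_univ y) (mem_univ x)
  · rw [← norm_eq_abs, ← norm_eq_abs]
    refine le_trans (le_of_eq ?_) this
    congr 1; ring
  · rw [norm_neg, norm_of_nonneg (by positivity), div_le_iff₀ (by positivity)]
    have h1 : exp (-((u ^ 2 + b ^ 2) / 2)) ≤ exp (-(b ^ 2 / 2)) :=
      exp_le_exp.2 (by nlinarith [sq_nonneg u])
    have h2 : b ≤ 2 * π * (u ^ 2 + b ^ 2) := by
      have h3 : b ≤ u ^ 2 + b ^ 2 := by nlinarith [sq_nonneg u]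
      nlinarith [pi_gt_three]
    rw [mul_comm b]
    exact mul_le_mul h1 h2 hb0.le (exp_pos _).le

lemma tendsto_mul_exp_neg_sq : Tendsto (fun b : ℝ => b * exp (-(b ^ 2 / 2))) atTop (𝓝 0) := by
  have h := tendsto_pow_mul_exp_neg_atTop_nhds_zero 1
  refine squeeze_zero' (by filter_upwards [eventually_ge_atTop 0] with b hb using by positivity) ?_ h
  filter_upwards [eventually_ge_atTop 2] with b hb
  rw [pow_one]
  have : exp (-(b ^ 2 / 2)) ≤ exp (-b) := exp_le_exp.2 (by nlinarith)
  gcongr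

lemma tendsto_line_div (ϑ k g : ℝ) : Tendsto (fun b => line ϑ k g b / b) atTop (𝓝 k) := by
  have h : Tendsto (fun b : ℝ => k + (ϑ + g) / b) atTop (𝓝 (k + 0)) :=
    tendsto_const_nhds.add (tendsto_const_nhds.div_atTop tendsto_id)
  rw [add_zero] at h
  refine h.congr' ?_
  filter_upwards [eventually_gt_atTop 0] with b hb
  rw [line]; field_simp

lemma tendsto_branch_div (ϑ lam h : ℝ) :
    Tendsto (fun b => branch ϑ lam h b / b) atTop (𝓝 √lam) := by
  have h1 : Tendsto (fun b : ℝ => lam + h / b ^ 2) atTop (𝓝 (lam + 0)) :=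
    tendsto_const_nhds.add (tendsto_const_nhds.div_atTop (tendsto_pow_atTop two_ne_zero))
  have h2 : Tendsto (fun b : ℝ => ϑ / b + √(lam + h / b ^ 2)) atTop (𝓝 (0 + √(lam + 0))) :=
    (tendsto_const_nhds.div_atTop tendsto_id).add (continuous_sqrt.continuousAt.tendsto.comp h1)
  rw [zero_add, add_zero] at h2
  refine h2.congr' ?_
  filter_upwards [eventually_gt_atTop 0] with b hb
  rw [branch, add_div]
  congr 1
  rw [eq_div_iff hb.ne']
  nth_rewrite 2 [← sqrt_sq hb.le]
  rw [← sqrt_mul' _ (by positivity)]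
  congr 1; field_simp

lemma tendsto_argRight {f : ℝ → ℝ} {c : ℝ} (hf : Tendsto (fun b => f b / b) atTop (𝓝 c)) :
    Tendsto (fun b => argRight (f b, b)) atTop (𝓝 (π / 2 - arctan c)) := by
  refine (tendsto_const_nhds.sub ((continuous_arctan.tendsto c).comp hf)).congr' ?_
  filter_upwards [eventually_gt_atTop 0] with b hb
  rw [argRight_of_nonneg (Or.inr hb.ne') hb.le, axisAngle_eq_arctan hb]
  rfl

lemma phiLam_eq {lam : ℝ} (hlam : 0 < lam) : phiLam lam = π / 2 - arctan √lam := by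
  rw [phiLam, one_div, arctan_inv_of_pos (sqrt_pos.2 hlam)]

lemma argLeft_eq_argRight {p : ℝ × ℝ} (hp : 0 < p.2) : argLeft p = argRight p := by
  rw [argLeft_of_nonneg (Or.inr hp.ne') hp.le, argRight_of_nonneg (Or.inr hp.ne') hp.le]

lemma measureReal_domainD_of_Icc {ϑ lam h k g a b : ℝ} (hab : a ≤ b)
    (hS : ∀ v, branch ϑ lam h v ≤ line ϑ k g v ↔ v ∈ Icc a b) :
    ((gaussianReal 0 1).prod (gaussianReal 0 1)).real (domainD ϑ lam h k g) =
      (∫ v in a..b, gaussPdf v * gaussCdf (line ϑ k g v)) -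
        ∫ v in a..b, gaussPdf v * gaussCdf (branch ϑ lam h v) := by
  have hS' : {v | branch ϑ lam h v ≤ line ϑ k g v} = Icc a b := ext hS
  rw [measureReal_domainD, hS', integral_Icc_eq_integral_Ioc, ← intervalIntegral.integral_of_le hab,
    intervalIntegral.integral_sub (intervalIntegrable_gauss_line k g a b)
      (intervalIntegrable_gauss_branch a b)]

lemma tendsto_measureReal_domainD {ϑ lam h k g a : ℝ}
    (hS : ∀ v, branch ϑ lam h v ≤ line ϑ k g v ↔ a ≤ v) :
    Tendsto (fun b => (∫ v in a..b, gaussPdf v * gaussCdf (line ϑ k g v)) -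
        ∫ v in a..b, gaussPdf v * gaussCdf (branch ϑ lam h v)) atTop
      (𝓝 (((gaussianReal 0 1).prod (gaussianReal 0 1)).real (domainD ϑ lam h k g))) := by
  have hS' : {v | branch ϑ lam h v ≤ line ϑ k g v} = Ici a := ext hS
  rw [measureReal_domainD, hS', integral_Ici_eq_integral_Ioi]
  refine (intervalIntegral_tendsto_integral_Ioi a
    ((integrable_gaussPdf_mul_gaussCdf (continuous_line ϑ k g)).sub
      (integrable_gaussPdf_mul_gaussCdf (continuous_branch ϑ lam h))).integrableOn
    tendsto_id).congr fun b => ?_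
  exact intervalIntegral.integral_sub (intervalIntegrable_gauss_line k g a b)
    (intervalIntegrable_gauss_branch a b)

/-- The potentials cancel at both endpoints and the angles at `b`. The angles at `a` stay
independent, because line and branch may use determinations that differ by `2 * π`. -/
lemma measureReal_eq_of_Icc {ϑ lam h k g a b α αl w wl : ℝ} (hab : a ≤ b)
    (hS : ∀ v, branch ϑ lam h v ≤ line ϑ k g v ↔ v ∈ Icc a b)
    (ha : branch ϑ lam h a = line ϑ k g a) (hb : branch ϑ lam h b = line ϑ k g b)
    (hl : ∫ v in a..b, gaussPdf v * gaussCdf (line ϑ k g v) =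
      potential (line ϑ k g b, b) - potential (line ϑ k g a, a) +
        (argRight (line ϑ k g b, b) - αl) / (2 * π) - wl)
    (hbr : ∫ v in a..b, gaussPdf v * gaussCdf (branch ϑ lam h v) =
      potential (branch ϑ lam h b, b) - potential (branch ϑ lam h a, a) +
        (argRight (branch ϑ lam h b, b) - α) / (2 * π) - w) :
    ((gaussianReal 0 1).prod (gaussianReal 0 1)).real (domainD ϑ lam h k g) =
      (α - αl) / (2 * π) - wl + w := by
  rw [measureReal_domainD_of_Icc hab hS, hl, hbr, ha, hb]
  ring

/-- The angular integrals are continuous functions of the final angle, so they pass to the limiting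
directions `π / 2 - phiK k` of the line and `phiLam lam` of the asymptote. -/
lemma measureReal_eq_of_Ici {ϑ lam h k g a α αl : ℝ} {w wl : ℝ → ℝ} (hlam : 0 < lam)
    (hS : ∀ v, branch ϑ lam h v ≤ line ϑ k g v ↔ a ≤ v)
    (ha : branch ϑ lam h a = line ϑ k g a) (hwl : Continuous wl) (hw : Continuous w)
    (hl : ∀ᶠ b in atTop, ∫ v in a..b, gaussPdf v * gaussCdf (line ϑ k g v) =
      potential (line ϑ k g b, b) - potential (line ϑ k g a, a) +
        (argRight (line ϑ k g b, b) - αl) / (2 * π) - wl (argRight (line ϑ k g b, b)))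
    (hbr : ∀ᶠ b in atTop, ∫ v in a..b, gaussPdf v * gaussCdf (branch ϑ lam h v) =
      potential (branch ϑ lam h b, b) - potential (branch ϑ lam h a, a) +
        (argRight (branch ϑ lam h b, b) - α) / (2 * π) - w (argRight (branch ϑ lam h b, b))) :
    ((gaussianReal 0 1).prod (gaussianReal 0 1)).real (domainD ϑ lam h k g) =
      (α - αl) / (2 * π) - wl (π / 2 - phiK k) + w (phiLam lam) := by
  refine tendsto_nhds_unique (tendsto_measureReal_domainD hS) ?_
  have h1 : Tendsto (fun b => (potential (line ϑ k g b, b) - potential (branch ϑ lam h b, b)) +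
      (argRight (line ϑ k g b, b) - argRight (branch ϑ lam h b, b)) / (2 * π)) atTop (𝓝 0) := by
    have h0 : Tendsto (fun b : ℝ => (|k| + |g|) * (b * exp (-(b ^ 2 / 2)))) atTop (𝓝 0) := by
      simpa using tendsto_mul_exp_neg_sq.const_mul (|k| + |g|)
    refine squeeze_zero_norm' ?_ h0
    filter_upwards [eventually_ge_atTop 1, eventually_ge_atTop a] with b hb hab
    refine (abs_sub_potential_le hb _ _).trans ?_
    have h2 := (hS b).2 hab
    rw [abs_of_nonneg (sub_nonneg.2 h2)]
    -- The segment grows at most linearly (using `1 ≤ b`), which the Gaussian factor beats.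
    have h3 : line ϑ k g b - branch ϑ lam h b ≤ (|k| + |g|) * b := by
      unfold line branch
      have := sqrt_nonneg (lam * b ^ 2 + h)
      have h4 := le_abs_self k
      have h5 := le_abs_self g
      have h6 := abs_nonneg g
      nlinarith
    calc _ ≤ exp (-(b ^ 2 / 2)) * ((|k| + |g|) * b) := by gcongr
      _ = _ := by ring
  have h2 := (hwl.tendsto _).comp (tendsto_argRight (tendsto_line_div ϑ k g))
  have h3 := (hw.tendsto _).comp (tendsto_argRight (tendsto_branch_div ϑ lam h))
  rw [← phiLam_eq hlam] at h3
  have h4 := ((h1.add_const ((α - αl) / (2 * π))).sub h2).add h3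
  rw [zero_add] at h4
  refine h4.congr' ?_
  filter_upwards [hl, hbr] with b hl hbr
  simp only [Function.comp]
  rw [hl, hbr, ha]
  ring

/-! ### Angles at the lower endpoint, expressed through `axisAngle` -/

lemma integral_line_of_neg {ϑ k g a b : ℝ} (ha : a < 0) (hb : 0 < b) (hc : 0 ≤ ϑ + g) :
    ∫ v in a..b, gaussPdf v * gaussCdf (line ϑ k g v) =
      potential (line ϑ k g b, b) - potential (line ϑ k g a, a) +
        (argRight (line ϑ k g b, b) - -axisAngle (line ϑ k g a, a)) / (2 * π) -
        ∫ φ in (-axisAngle (line ϑ k g a, a) + phiK k)..(argRight (line ϑ k g b, b) + phiK k),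
          Psi ϑ g k φ := by
  rcases hc.eq_or_lt with hc | hc
  · exact integral_line_of_eq_zero hc.symm _ _ _ _
  · rw [integral_line_right (ha.trans hb).le (Or.inl hc), argRight_of_neg (p := (line ϑ k g a, a)) ha]

lemma integral_line_of_neg_left {ϑ k g a b : ℝ} (ha : a < 0) (hb : 0 < b) (hc : ϑ + g < 0) :
    ∫ v in a..b, gaussPdf v * gaussCdf (line ϑ k g v) =
      potential (line ϑ k g b, b) - potential (line ϑ k g a, a) +
        (argRight (line ϑ k g b, b) - (2 * π - axisAngle (line ϑ k g a, a))) / (2 * π) -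
        ∫ φ in (2 * π - axisAngle (line ϑ k g a, a) + phiK k)..
          (argRight (line ϑ k g b, b) + phiK k), Psi ϑ g k φ := by
  rw [integral_line_left (ha.trans hb).le hc, argLeft_of_neg (p := (line ϑ k g a, a)) ha,
    argLeft_eq_argRight (p := (line ϑ k g b, b)) hb]

lemma integral_line_of_nonneg {ϑ k g a b : ℝ} (ha : 0 ≤ a) (hb : 0 < b) (hab : a ≤ b) :
    ∫ v in a..b, gaussPdf v * gaussCdf (line ϑ k g v) =
      potential (line ϑ k g b, b) - potential (line ϑ k g a, a) +
        (argRight (line ϑ k g b, b) - axisAngle (line ϑ k g a, a)) / (2 * π) -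
        ∫ φ in (axisAngle (line ϑ k g a, a) + phiK k)..(argRight (line ϑ k g b, b) + phiK k),
          Psi ϑ g k φ := by
  have hp (h : ϑ + g ≠ 0) : line ϑ k g a = ϑ + g ∨ a ≠ 0 := by
    rcases eq_or_ne a 0 with rfl | h0
    · left; simp [line]
    · exact Or.inr h0
  rcases lt_trichotomy (ϑ + g) 0 with hc | hc | hc
  · rw [integral_line_left hab hc, argLeft_of_nonneg (p := (line ϑ k g a, a)) _ ha,
      argLeft_eq_argRight (p := (line ϑ k g b, b)) hb]
    exact (hp hc.ne).imp (fun h => h.trans_lt hc) id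
  · exact integral_line_of_eq_zero hc _ _ _ _
  · rw [integral_line_right hab (Or.inl hc), argRight_of_nonneg (p := (line ϑ k g a, a)) _ ha]
    exact (hp hc.ne').imp (fun h => hc.trans_eq h.symm) id

/-- The vertex is not the origin, so one of the two angle determinations is smooth along the entire
branch. -/
lemma add_sqrt_ne_zero {ϑ h : ℝ} (hh : 0 ≤ h) (hne : ϑ ^ 2 ≠ h) : ϑ + √h ≠ 0 := by
  intro h0
  apply hne
  rw [eq_neg_of_add_eq_zero_left h0, neg_sq, sq_sqrt hh]

lemma integral_branch_of_neg_left {ϑ lam h a b : ℝ} (hlam : 0 < lam) (hh : 0 ≤ h)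
    (hne : ϑ ^ 2 ≠ h) (ha : a < 0) (hb : 0 < b) (hL : ϑ + √h < 0) :
    ∫ v in a..b, gaussPdf v * gaussCdf (branch ϑ lam h v) =
      potential (branch ϑ lam h b, b) - potential (branch ϑ lam h a, a) +
        (argRight (branch ϑ lam h b, b) - (2 * π - axisAngle (branch ϑ lam h a, a))) / (2 * π) -
        ∫ φ in (2 * π - axisAngle (branch ϑ lam h a, a))..(argRight (branch ϑ lam h b, b)),
          Upsilon ϑ lam h φ := by
  rw [integral_branch_left hlam hh hne (ha.trans hb).le hL, argLeft_of_neg (p := (branch ϑ lam h a, a)) ha,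
    argLeft_eq_argRight (p := (branch ϑ lam h b, b)) hb]

lemma integral_branch_of_nonneg {ϑ lam h a b : ℝ} (hlam : 0 < lam) (hh : 0 ≤ h)
    (hne : ϑ ^ 2 ≠ h) (ha : 0 ≤ a) (hb : 0 < b) (hab : a ≤ b) (hϑ : ϑ < 0)
    (ht : tangentNum ϑ lam h a ≤ 0) :
    ∫ v in a..b, gaussPdf v * gaussCdf (branch ϑ lam h v) =
      potential (branch ϑ lam h b, b) - potential (branch ϑ lam h a, a) +
        (argRight (branch ϑ lam h b, b) - axisAngle (branch ϑ lam h a, a)) / (2 * π) -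
        ∫ φ in (axisAngle (branch ϑ lam h a, a))..(argRight (branch ϑ lam h b, b)),
          Upsilon ϑ lam h φ := by
  rcases lt_or_gt_of_ne (add_sqrt_ne_zero hh hne) with hL | hR
  · rw [integral_branch_left hlam hh hne hab hL, argLeft_of_nonneg (p := (branch ϑ lam h a, a)) _ ha,
      argLeft_eq_argRight (p := (branch ϑ lam h b, b)) hb]
    rcases eq_or_ne a 0 with rfl | h0
    · left; simpa [branch] using hL
    · exact Or.inr h0
  · rw [integral_branch_right_nonpos hlam hh hne hab hR, argRight_of_nonneg (p := (branch ϑ lam h a, a)) _ ha]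
    · exact Or.inl (branch_pos hlam hR a)
    · intro v hv
      refine (tangentNum_anti hlam hϑ.le ?_).trans ht
      rw [abs_of_nonneg ha, abs_of_nonneg (ha.trans hv.1)]
      exact hv.1

/-! ### From tangent abscissas to the sign of `tangentNum` -/

section Sign

variable {ϑ lam h v : ℝ}

lemma tangentNum_nonneg_of_tan (hh : 0 ≤ h)
    (ht : 0 ≤ ϑ + h / √(lam * v ^ 2 + h)) : 0 ≤ tangentNum ϑ lam h v := by
  rcases (sqrt_nonneg (lam * v ^ 2 + h)).eq_or_lt with h0 | h0
  · rw [tangentNum, ← h0, mul_zero, zero_add]; exact hh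
  · have := mul_nonneg ht h0.le
    rwa [add_mul, div_mul_cancel₀ _ h0.ne'] at this

lemma neg_of_tan_neg (hh : 0 ≤ h) (ht : ϑ + h / √(lam * v ^ 2 + h) < 0) : ϑ < 0 := by
  have : 0 ≤ h / √(lam * v ^ 2 + h) := by positivity
  linarith

lemma tangentNum_nonpos_of_tan (hlam : 0 < lam)
    (ht : ϑ + h / √(lam * v ^ 2 + h) < 0) : tangentNum ϑ lam h v ≤ 0 := by
  rcases (sqrt_nonneg (lam * v ^ 2 + h)).eq_or_lt with h0 | h0
  · have : lam * v ^ 2 + h ≤ 0 := sqrt_eq_zero'.1 h0.symm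
    rw [tangentNum, ← h0, mul_zero, zero_add]
    have : 0 ≤ lam * v ^ 2 := by positivity
    linarith
  · have := mul_neg_of_neg_of_pos ht h0
    rw [add_mul, div_mul_cancel₀ _ h0.ne'] at this
    exact this.le

/-- Since `h / √(lam * v ^ 2 + h) ≤ √h`, a nonnegative tangent abscissa forces `-ϑ ≤ √h`; `hne`
makes this strict. -/
lemma sq_lt_of_tan (hlam : 0 < lam) (hh : 0 ≤ h) (hne : ϑ ^ 2 ≠ h) (hϑ : ϑ < 0)
    (ht : 0 ≤ ϑ + h / √(lam * v ^ 2 + h)) : ϑ ^ 2 < h := by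
  rcases hh.eq_or_lt with rfl | h0
  · rw [zero_div, add_zero] at ht; linarith
  have hs := sqrt_pos.2 h0
  have h1 : √h ≤ √(lam * v ^ 2 + h) := sqrt_le_sqrt (by nlinarith [sq_nonneg v])
  have h2 : h / √(lam * v ^ 2 + h) ≤ √h := by
    rw [div_le_iff₀ (hs.trans_le h1)]
    nlinarith [mul_self_sqrt hh]
  refine lt_of_le_of_ne ?_ hne
  nlinarith [sq_sqrt hh]

lemma sq_lt_of_add_sqrt_nonneg (hh : 0 ≤ h) (hne : ϑ ^ 2 ≠ h) (hϑ : ϑ < 0) (hR : 0 ≤ ϑ + √h) :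
    ϑ ^ 2 < h := by
  refine lt_of_le_of_ne ?_ hne
  nlinarith [sq_sqrt hh]

lemma add_sqrt_pos_of_tan (hlam : 0 < lam) (hh : 0 ≤ h) (hne : ϑ ^ 2 ≠ h)
    (ht : 0 ≤ ϑ + h / √(lam * v ^ 2 + h)) : 0 < ϑ + √h := by
  rcases lt_or_ge ϑ 0 with hϑ | hϑ
  · exact add_sqrt_pos_of_sq_lt (sq_lt_of_tan hlam hh hne hϑ ht)
  · exact lt_of_le_of_ne (by positivity) (add_sqrt_ne_zero hh hne).symm

end Sign

/-! ### Where the line is to the right of the branch -/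

section Intersection

variable {ϑ lam h k g : ℝ}

lemma line_vA (hne : k ^ 2 ≠ lam) : line ϑ k g (vA lam h k g) = uA ϑ lam h k g := by
  have : lam - k ^ 2 ≠ 0 := sub_ne_zero.2 hne.symm
  unfold line vA uA
  field_simp
  ring

lemma line_vB (hne : k ^ 2 ≠ lam) : line ϑ k g (vB lam h k g) = uB ϑ lam h k g := by
  have : lam - k ^ 2 ≠ 0 := sub_ne_zero.2 hne.symm
  unfold line vB uB
  field_simp
  ring

lemma phiA_eq (hne : k ^ 2 ≠ lam) :
    phiA ϑ lam h k g = axisAngle (line ϑ k g (vA lam h k g), vA lam h k g) := by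
  rw [line_vA hne]; rfl

lemma phiB_eq (hne : k ^ 2 ≠ lam) :
    phiB ϑ lam h k g = axisAngle (line ϑ k g (vB lam h k g), vB lam h k g) := by
  rw [line_vB hne]; rfl

lemma quadratic_factor (hne : k ^ 2 ≠ lam) (hD : 0 ≤ Delta lam h k g) (v : ℝ) :
    lam * v ^ 2 + h - (k * v + g) ^ 2 =
      (lam - k ^ 2) * ((v - vA lam h k g) * (v - vB lam h k g)) := by
  have h1 : lam - k ^ 2 ≠ 0 := sub_ne_zero.2 hne.symm
  have h2 := sq_sqrt hD
  unfold vA vB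
  field_simp
  nth_rewrite 2 [Delta] at h2
  linear_combination h2

lemma branch_le_line_iff (v : ℝ) :
    branch ϑ lam h v ≤ line ϑ k g v ↔ √(lam * v ^ 2 + h) ≤ k * v + g := by
  unfold branch line
  constructor <;> intro h <;> linarith

lemma branch_eq_line_of_root {v : ℝ}
    (hv : branch ϑ lam h v ≤ line ϑ k g v) (h0 : lam * v ^ 2 + h - (k * v + g) ^ 2 = 0) :
    branch ϑ lam h v = line ϑ k g v := by
  rw [branch_le_line_iff] at hv
  have : √(lam * v ^ 2 + h) = k * v + g := by
    rw [sub_eq_zero.1 h0, sqrt_sq ((sqrt_nonneg _).trans hv)]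
  rw [branch, line, this]; ring

/-- This converts the comparison of `g` with `√h` into that of `g * k` with `√Δ`, which is the sign
of `vA` up to the sign of `lam - k ^ 2`. -/
lemma Delta_sub (lam h k g : ℝ) : Delta lam h k g - (g * k) ^ 2 = (lam - k ^ 2) * (g ^ 2 - h) := by
  unfold Delta; ring

lemma vA_le_vB (hk : k ^ 2 < lam) : vA lam h k g ≤ vB lam h k g := by
  have : 0 < lam - k ^ 2 := by linarith
  have h1 := sqrt_nonneg (Delta lam h k g)
  unfold vA vB
  gcongr
  linarith

lemma vB_le_vA (hk : lam < k ^ 2) : vB lam h k g ≤ vA lam h k g := by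
  have : lam - k ^ 2 < 0 := by linarith
  have h1 := sqrt_nonneg (Delta lam h k g)
  unfold vA vB
  exact div_le_div_of_nonpos_of_le this.le (by linarith)

lemma branch_le_line_iff_mem_Icc (hlam : k ^ 2 < lam) (hh : 0 ≤ h) (hg : 0 < g)
    (hD : 0 ≤ Delta lam h k g) (v : ℝ) : branch ϑ lam h v ≤ line ϑ k g v ↔
      v ∈ Icc (vA lam h k g) (vB lam h k g) := by
  have hq := quadratic_factor hlam.ne hD v
  have hp : 0 < lam - k ^ 2 := by linarith
  have hAB := vA_le_vB (h := h) (g := g) hlam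
  rw [branch_le_line_iff, sqrt_le_iff]
  constructor
  · rintro ⟨h1, h2⟩
    have h3 : (v - vA lam h k g) * (v - vB lam h k g) ≤ 0 := by
      by_contra! h
      have := mul_pos hp h
      linarith
    constructor
    · by_contra! h
      exact absurd h3 (not_le.2 (mul_pos_of_neg_of_neg (by linarith) (by linarith)))
    · by_contra! h
      exact absurd h3 (not_le.2 (mul_pos (by linarith) (by linarith)))
  · rintro ⟨h1, h2⟩
    have h3 := mul_nonpos_of_nonneg_of_nonpos hp.le
      (mul_nonpos_of_nonneg_of_nonpos (sub_nonneg.2 h1) (sub_nonpos.2 h2))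
    refine ⟨?_, by linarith⟩
    -- Squaring loses nothing: if `k * v + g < 0 < g`, then `(k * v + g) ^ 2 < (k * v) ^ 2 ≤ lam * v
    -- ^ 2`, which contradicts `h3`.
    by_contra! h4
    have h5 : k * v < 0 := by linarith
    have h6 : (k * v + g) ^ 2 < (k * v) ^ 2 := by nlinarith
    nlinarith [sq_nonneg v]

lemma Delta_nonneg (hlam : 0 < lam) (hk : lam < k ^ 2) (hh : 0 ≤ h) : 0 ≤ Delta lam h k g := by
  have : 0 ≤ k ^ 2 - lam := by linarith
  unfold Delta; positivity

/-- When `k` exceeds the asymptotic slope `√lam`, the root `vA` belongs to the right branch and `vB`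
to the left one, as the signs of `k * v + g` at the roots show. -/
lemma branch_le_line_iff_le (hk : 0 < k) (hlam : 0 < lam) (hlt : lam < k ^ 2) (hh : 0 ≤ h)
    (v : ℝ) : branch ϑ lam h v ≤ line ϑ k g v ↔ vA lam h k g ≤ v := by
  have hD := Delta_nonneg (g := g) hlam hlt hh
  have hq := quadratic_factor hlt.ne' hD v
  have hp : 0 < k ^ 2 - lam := by linarith
  have hAB := vB_le_vA (h := h) (g := g) hlt
  have hd := sqrt_nonneg (Delta lam h k g)
  have hd2 := sq_sqrt hD
  have hsq : (lam * g) ^ 2 ≤ (k * √(Delta lam h k g)) ^ 2 := by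
    rw [mul_pow k, hd2, Delta]
    have : 0 ≤ k ^ 2 * (h * (k ^ 2 - lam)) + lam * g ^ 2 * (k ^ 2 - lam) := by positivity
    nlinarith
  have habs := abs_le_of_sq_le_sq' hsq (by positivity)
  have hn : lam - k ^ 2 ≠ 0 := by linarith
  have eA : k * vA lam h k g + g = (k * √(Delta lam h k g) - lam * g) / (k ^ 2 - lam) := by
    rw [vA, ← neg_sub (k ^ 2) lam] at *
    field_simp
    ring
  have eB : k * vB lam h k g + g = (-(k * √(Delta lam h k g)) - lam * g) / (k ^ 2 - lam) := by
    rw [vB, ← neg_sub (k ^ 2) lam] at *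
    field_simp
    ring
  have hA : 0 ≤ k * vA lam h k g + g := by
    rw [eA]; exact div_nonneg (by linarith) hp.le
  have hB : k * vB lam h k g + g ≤ 0 := by
    rw [eB]; exact div_nonpos_of_nonpos_of_nonneg (by linarith) hp.le
  rw [branch_le_line_iff, sqrt_le_iff]
  constructor
  · rintro ⟨h1, h2⟩
    by_contra! hv
    have h3 : 0 ≤ (v - vA lam h k g) * (v - vB lam h k g) := by
      by_contra! h
      have := mul_pos_of_neg_of_neg (show lam - k ^ 2 < 0 by linarith) h
      linarith
    have h4 : v ≤ vB lam h k g := by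
      by_contra! h
      exact absurd h3 (not_le.2 (mul_neg_of_neg_of_pos (by linarith) (by linarith)))
    -- A solution below `vB` must have `k * v + g = 0`, which forces `h = g = v = 0`; then `vA = 0`
    -- as well, against `v < vA`.
    have h5 : k * v + g = 0 := le_antisymm (by nlinarith) h1
    rw [h5] at h2
    have h6 : 0 ≤ lam * v ^ 2 := by positivity
    have h0 : h = 0 := by linarith
    have hv0 : v = 0 := by
      have : lam * v ^ 2 = 0 := by linarith
      simpa [hlam.ne'] using this
    have hg0 : g = 0 := by rw [hv0] at h5; linarith
    have : vA lam h k g = 0 := by simp [vA, Delta, h0, hg0]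
    linarith
  · intro hv
    refine ⟨by nlinarith, ?_⟩
    have : 0 ≤ (v - vA lam h k g) * (v - vB lam h k g) :=
      mul_nonneg (by linarith) (by linarith)
    nlinarith

end Intersection

/-! ### Arc types and assembly of the two boundary curves -/

/-- Green's theorem along the line between the heights `a` and `b`, where `α` is the polar angle
at height `a`. -/
def GreenLine (ϑ k g a α b : ℝ) : Prop :=
  ∫ v in a..b, gaussPdf v * gaussCdf (line ϑ k g v) =
    potential (line ϑ k g b, b) - potential (line ϑ k g a, a) +
      (argRight (line ϑ k g b, b) - α) / (2 * π) -
      ∫ φ in (α + phiK k)..(argRight (line ϑ k g b, b) + phiK k), Psi ϑ g k φ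

/-- Green's theorem along the branch between the heights `a` and `b`, where `α` is the polar angle
at height `a`, and `w` is the integral of the angular density as a function of the polar angle
at height `b`. -/
def GreenBranch (ϑ lam h a α : ℝ) (w : ℝ → ℝ) (b : ℝ) : Prop :=
  ∫ v in a..b, gaussPdf v * gaussCdf (branch ϑ lam h v) =
    potential (branch ϑ lam h b, b) - potential (branch ϑ lam h a, a) +
      (argRight (branch ϑ lam h b, b) - α) / (2 * π) - w (argRight (branch ϑ lam h b, b))

/-- The angular integral along a positively oriented arc. -/
def arcPos (ϑ lam h α β : ℝ) : ℝ := ∫ φ in (α + π)..(β + π), Upsilon ϑ lam h φ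

/-- The angular integral along a negatively oriented arc. -/
def arcNeg (ϑ lam h α β : ℝ) : ℝ := ∫ φ in α..β, Upsilon ϑ lam h φ

/-- The angular integral along an arc that contains the upper point of tangency. -/
def arcTangent (ϑ lam h α β : ℝ) : ℝ :=
  arcPos ϑ lam h α (phiM ϑ lam h) + arcNeg ϑ lam h (phiM ϑ lam h) β

/-- The angular integral along an arc that contains both points of tangency. -/
def arcTangents (ϑ lam h α β : ℝ) : ℝ :=
  arcNeg ϑ lam h α (-phiM ϑ lam h) + arcPos ϑ lam h (-phiM ϑ lam h) (phiM ϑ lam h) +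
    arcNeg ϑ lam h (phiM ϑ lam h) β

section

variable {ϑ lam h k g a b : ℝ}

lemma continuous_arcNeg (α : ℝ) : Continuous (arcNeg ϑ lam h α) :=
  intervalIntegral.continuous_primitive (intervalIntegrable_Upsilon ϑ lam h) α

lemma continuous_arcPos (α : ℝ) : Continuous (arcPos ϑ lam h α) :=
  (intervalIntegral.continuous_primitive (intervalIntegrable_Upsilon ϑ lam h) (α + π)).comp
    (continuous_add_const π)

lemma continuous_arcTangent (α : ℝ) : Continuous (arcTangent ϑ lam h α) :=
  continuous_const.add (continuous_arcNeg _)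

lemma continuous_arcTangents (α : ℝ) : Continuous (arcTangents ϑ lam h α) :=
  continuous_const.add (continuous_arcNeg _)

lemma measureReal_eq_of_Icc_of_green {α αl : ℝ} {w : ℝ → ℝ} (hab : a ≤ b) (hb0 : 0 < b)
    (hS : ∀ v, branch ϑ lam h v ≤ line ϑ k g v ↔ v ∈ Icc a b)
    (ha : branch ϑ lam h a = line ϑ k g a) (hb : branch ϑ lam h b = line ϑ k g b)
    (hl : GreenLine ϑ k g a αl b) (hw : GreenBranch ϑ lam h a α w b) :
    ((gaussianReal 0 1).prod (gaussianReal 0 1)).real (domainD ϑ lam h k g) =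
      (α - αl) / (2 * π) - (∫ φ in (αl + phiK k)..(axisAngle (line ϑ k g b, b) + phiK k),
        Psi ϑ g k φ) + w (axisAngle (line ϑ k g b, b)) := by
  rw [measureReal_eq_of_Icc hab hS ha hb hl hw, hb,
    argRight_of_nonneg (p := (line ϑ k g b, b)) (Or.inr hb0.ne') hb0.le]

lemma measureReal_eq_of_Ici_of_green {α αl : ℝ} {w : ℝ → ℝ} (hlam : 0 < lam)
    (hS : ∀ v, branch ϑ lam h v ≤ line ϑ k g v ↔ a ≤ v)
    (ha : branch ϑ lam h a = line ϑ k g a) (hwc : Continuous w)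
    (hl : ∀ᶠ b in atTop, GreenLine ϑ k g a αl b)
    (hw : ∀ᶠ b in atTop, GreenBranch ϑ lam h a α w b) :
    ((gaussianReal 0 1).prod (gaussianReal 0 1)).real (domainD ϑ lam h k g) =
      (α - αl) / (2 * π) - (∫ φ in (αl + phiK k)..(π / 2), Psi ϑ g k φ) + w (phiLam lam) := by
  have hc : Continuous fun x => ∫ φ in (αl + phiK k)..(x + phiK k), Psi ϑ g k φ :=
    (intervalIntegral.continuous_primitive (intervalIntegrable_Psi ϑ g k) _).comp
      (continuous_add_const (phiK k))
  rw [measureReal_eq_of_Ici hlam hS ha hc hwc hl hw, sub_add_cancel]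

lemma greenBranch_arcPos (hlam : 0 < lam) (hh : 0 ≤ h) (hne : ϑ ^ 2 ≠ h) (hR : 0 < ϑ + √h)
    (hab : |a| ≤ b) (ht : 0 ≤ tangentNum ϑ lam h b) :
    GreenBranch ϑ lam h a (argRight (branch ϑ lam h a, a))
      (arcPos ϑ lam h (argRight (branch ϑ lam h a, a))) b := by
  refine integral_branch_right_nonneg hlam hh hne ((le_abs_self a).trans hab) hR fun v hv =>
    tangentNum_nonneg hlam hh ?_ ht
  rw [abs_of_nonneg ((abs_nonneg a).trans hab), abs_le]
  exact ⟨by linarith [hv.1, (abs_le.1 hab).1], hv.2⟩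

lemma greenBranch_arcTangent (hlam : 0 < lam) (hϑ : ϑ < 0) (hlt : ϑ ^ 2 < h)
    (ha : 0 ≤ tangentNum ϑ lam h a) (hb : tangencyHeight ϑ lam h ≤ b) :
    GreenBranch ϑ lam h a (argRight (branch ϑ lam h a, a))
      (arcTangent ϑ lam h (argRight (branch ϑ lam h a, a))) b :=
  integral_branch_right_tangent hlam hϑ hlt ((tangentNum_nonneg_iff hlam hϑ hlt).1 ha) hb

lemma greenBranch_arcTangents (hlam : 0 < lam) (hϑ : ϑ < 0) (hlt : ϑ ^ 2 < h) (ha0 : a < 0)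
    (ha : tangentNum ϑ lam h a ≤ 0) (hb : tangencyHeight ϑ lam h ≤ b) :
    GreenBranch ϑ lam h a (argRight (branch ϑ lam h a, a))
      (arcTangents ϑ lam h (argRight (branch ϑ lam h a, a))) b := by
  refine integral_branch_right_tangents hlam hϑ hlt ?_ hb
  have := le_abs_of_tangentNum_nonpos hlam hϑ hlt ha
  rw [abs_of_neg ha0] at this
  linarith

/-- `Upsilon` is even. This moves the arc from `A` to the lower point of tangency to positive
angles. -/
lemma integral_Upsilon_neg (x y : ℝ) :
    ∫ φ in (-x)..(-y), Upsilon ϑ lam h φ = -∫ φ in x..y, Upsilon ϑ lam h φ := by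
  rw [← intervalIntegral.integral_comp_neg, intervalIntegral.integral_symm]
  congr 2
  ext φ
  simp [Upsilon]

lemma tanA_eq (hne : k ^ 2 ≠ lam)
    (ha : branch ϑ lam h (vA lam h k g) = line ϑ k g (vA lam h k g)) :
    tanA ϑ lam h k g = ϑ + h / √(lam * vA lam h k g ^ 2 + h) := by
  rw [tanA, ← line_vA hne, ← ha, branch, add_sub_cancel_left]

lemma tanB_eq (hne : k ^ 2 ≠ lam)
    (hb : branch ϑ lam h (vB lam h k g) = line ϑ k g (vB lam h k g)) :
    tanB ϑ lam h k g = ϑ + h / √(lam * vB lam h k g ^ 2 + h) := by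
  rw [tanB, ← line_vB hne, ← hb, branch, add_sub_cancel_left]

lemma greenLine_of_neg (ha : a < 0) (hb : 0 < b) (hc : 0 ≤ ϑ + g) :
    GreenLine ϑ k g a (-axisAngle (line ϑ k g a, a)) b := integral_line_of_neg ha hb hc

lemma greenLine_of_neg_left (ha : a < 0) (hb : 0 < b) (hc : ϑ + g < 0) :
    GreenLine ϑ k g a (2 * π - axisAngle (line ϑ k g a, a)) b := integral_line_of_neg_left ha hb hc

lemma greenLine_of_nonneg (ha : 0 ≤ a) (hb : 0 < b) (hab : a ≤ b) :
    GreenLine ϑ k g a (axisAngle (line ϑ k g a, a)) b := integral_line_of_nonneg ha hb hab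

lemma greenBranch_of_neg_left (hlam : 0 < lam) (hh : 0 ≤ h) (hne : ϑ ^ 2 ≠ h) (ha : a < 0)
    (hb : 0 < b) (hL : ϑ + √h < 0) :
    GreenBranch ϑ lam h a (2 * π - axisAngle (branch ϑ lam h a, a))
      (arcNeg ϑ lam h (2 * π - axisAngle (branch ϑ lam h a, a))) b :=
  integral_branch_of_neg_left hlam hh hne ha hb hL

lemma greenBranch_of_nonneg (hlam : 0 < lam) (hh : 0 ≤ h) (hne : ϑ ^ 2 ≠ h) (ha : 0 ≤ a)
    (hb : 0 < b) (hab : a ≤ b) (hϑ : ϑ < 0) (ht : tangentNum ϑ lam h a ≤ 0) :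
    GreenBranch ϑ lam h a (axisAngle (branch ϑ lam h a, a))
      (arcNeg ϑ lam h (axisAngle (branch ϑ lam h a, a))) b :=
  integral_branch_of_nonneg hlam hh hne ha hb hab hϑ ht

lemma le_of_tangentNum_nonpos (hlam : 0 < lam) (hϑ : ϑ < 0) (hlt : ϑ ^ 2 < h) (hb : 0 < b)
    (ht : tangentNum ϑ lam h b ≤ 0) : tangencyHeight ϑ lam h ≤ b := by
  simpa [abs_of_pos hb] using le_abs_of_tangentNum_nonpos hlam hϑ hlt ht

lemma branch_vA (hne : k ^ 2 ≠ lam) (hD : 0 ≤ Delta lam h k g)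
    (hA : branch ϑ lam h (vA lam h k g) ≤ line ϑ k g (vA lam h k g)) :
    branch ϑ lam h (vA lam h k g) = line ϑ k g (vA lam h k g) :=
  branch_eq_line_of_root hA (by rw [quadratic_factor hne hD]; ring)

lemma branch_vB (hne : k ^ 2 ≠ lam) (hD : 0 ≤ Delta lam h k g)
    (hB : branch ϑ lam h (vB lam h k g) ≤ line ϑ k g (vB lam h k g)) :
    branch ϑ lam h (vB lam h k g) = line ϑ k g (vB lam h k g) :=
  branch_eq_line_of_root hB (by rw [quadratic_factor hne hD]; ring)

lemma vB_pos (hk : 0 < k) (hlt : k ^ 2 < lam) (hg : 0 < g) : 0 < vB lam h k g := by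
  have h1 : 0 < lam - k ^ 2 := by linarith
  unfold vB
  positivity

/-! ### The four nondegenerate regimes and the null case -/

theorem measureReal_domainD_eq_Inp (hk : 0 < k) (hh : 0 ≤ h) (hlt : k ^ 2 < lam) (hg : √h < g)
    (hD : 0 ≤ Delta lam h k g) (hne : ϑ ^ 2 ≠ h) :
    ((gaussianReal 0 1).prod (gaussianReal 0 1)).real (domainD ϑ lam h k g) =
      Inp ϑ lam h k g := by
  have hlam : 0 < lam := (sq_nonneg k).trans_lt hlt
  have hg0 : 0 < g := (sqrt_nonneg h).trans_lt hg
  have hp : 0 < lam - k ^ 2 := by linarith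
  have hS := branch_le_line_iff_mem_Icc (ϑ := ϑ) hlt hh hg0 hD
  have hAB := vA_le_vB (h := h) (g := g) hlt
  have ea := branch_vA hlt.ne hD ((hS _).2 ⟨le_rfl, hAB⟩)
  have eb := branch_vB hlt.ne hD ((hS _).2 ⟨hAB, le_rfl⟩)
  have hB := vB_pos (h := h) hk hlt hg0
  have hA : vA lam h k g < 0 := by
    have h1 : h < g ^ 2 := (sqrt_lt' hg0).1 hg
    have h2 := Delta_sub lam h k g
    have h3 : g * k < √(Delta lam h k g) := lt_sqrt_of_sq_lt (by nlinarith)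
    exact div_neg_of_neg_of_pos (by linarith) hp
  -- The midpoint of the roots is positive, so `B` is at least as far from the axis as `A`, and the
  -- tangent test at `B` covers the whole arc.
  have habs : |vA lam h k g| ≤ vB lam h k g := by
    rw [abs_le]
    refine ⟨?_, hAB⟩
    have : 0 ≤ vA lam h k g + vB lam h k g := by
      rw [vA, vB, ← add_div]
      have : 0 < g * k := by positivity
      exact div_nonneg (by linarith) hp.le
    linarith
  have tA := tanA_eq hlt.ne ea
  have tB := tanB_eq hlt.ne eb
  have eA := (phiA_eq (ϑ := ϑ) (h := h) (g := g) hlt.ne).symm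
  have eB := (phiB_eq (ϑ := ϑ) (h := h) (g := g) hlt.ne).symm
  have eA' : argRight (branch ϑ lam h (vA lam h k g), vA lam h k g) = -phiA ϑ lam h k g := by
    rw [argRight_of_neg (by exact hA), ea, eA]
  have e1 : -phiA ϑ lam h k g + phiK k = phiK k - phiA ϑ lam h k g := by ring
  have e2 : phiB ϑ lam h k g + phiK k = phiK k + phiB ϑ lam h k g := by ring
  have e3 : -phiA ϑ lam h k g + π = π - phiA ϑ lam h k g := by ring
  have e4 : phiB ϑ lam h k g + π = π + phiB ϑ lam h k g := by ring
  have e5 : phiM ϑ lam h + π = π + phiM ϑ lam h := by ring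
  have e6 : -phiM ϑ lam h + π = π - phiM ϑ lam h := by ring
  have e7 : 2 * π - phiA ϑ lam h k g + phiK k = phiK k - phiA ϑ lam h k g + 2 * π := by ring
  unfold Inp
  split_ifs with h1 h2 h3 h4
  · rw [tB] at h1
    have hR := add_sqrt_pos_of_tan hlam hh hne h1
    rw [measureReal_eq_of_Icc_of_green hAB hB hS ea eb (greenLine_of_neg hA hB (by linarith))
      (greenBranch_arcPos hlam hh hne hR habs (tangentNum_nonneg_of_tan hh h1)), eA, eB, eA', e1,
      e2, arcPos, e3, e4, Inp1]
    ring
  · rw [tB, tA] at h2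
    have hϑ := neg_of_tan_neg hh h2.1
    have hsq := sq_lt_of_tan hlam hh hne hϑ h2.2
    have hR := add_sqrt_pos_of_sq_lt hsq
    rw [measureReal_eq_of_Icc_of_green hAB hB hS ea eb (greenLine_of_neg hA hB (by linarith))
      (greenBranch_arcTangent hlam hϑ hsq (tangentNum_nonneg_of_tan hh h2.2)
        (le_of_tangentNum_nonpos hlam hϑ hsq hB (tangentNum_nonpos_of_tan hlam h2.1))),
      eA, eB, eA', e1, e2, arcTangent, arcPos, arcNeg, e3, e5, Inp2,
      intervalIntegral.integral_symm (phiM ϑ lam h) (phiB ϑ lam h k g)]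
    ring
  · rw [tA] at h3
    have hϑ := neg_of_tan_neg hh h3.1
    have hsq := sq_lt_of_add_sqrt_nonneg hh hne hϑ h3.2
    rw [tB, not_le] at h1
    rw [measureReal_eq_of_Icc_of_green hAB hB hS ea eb (greenLine_of_neg hA hB (by linarith))
      (greenBranch_arcTangents hlam hϑ hsq hA (tangentNum_nonpos_of_tan hlam h3.1)
        (le_of_tangentNum_nonpos hlam hϑ hsq hB (tangentNum_nonpos_of_tan hlam h1))),
      eA, eB, eA', e1, e2, arcTangents, arcPos, arcNeg, arcNeg, e5, e6, Inp3,
      intervalIntegral.integral_symm (phiM ϑ lam h) (phiB ϑ lam h k g), integral_Upsilon_neg]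
    ring
  -- The angle at `A` is `-phiA` on the line but `2 * π - phiA` on the branch; the difference over
  -- `2 * π` is the summand `1`.
  · rw [measureReal_eq_of_Icc_of_green hAB hB hS ea eb (greenLine_of_neg hA hB h4.2)
      (greenBranch_of_neg_left hlam hh hne hA hB h4.1), ea, eA, eB, e1, e2, arcNeg, Inp4,
      intervalIntegral.integral_symm (phiB ϑ lam h k g)]
    have := pi_ne_zero
    field_simp
    ring
  · have hA' : tanA ϑ lam h k g < 0 := by
      by_contra! h
      exact h2 ⟨not_le.1 h1, h⟩
    have hL : ϑ + √h < 0 := by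
      by_contra! h
      exact h3 ⟨hA', h⟩
    have hc : ϑ + g < 0 := by
      by_contra! h
      exact h4 ⟨hL, h⟩
    rw [measureReal_eq_of_Icc_of_green hAB hB hS ea eb (greenLine_of_neg_left hA hB hc)
      (greenBranch_of_neg_left hlam hh hne hA hB hL), ea, eA, eB, e7, e2, arcNeg, Inp5,
      intervalIntegral.integral_symm (phiB ϑ lam h k g),
      intervalIntegral.integral_symm (phiK k + phiB ϑ lam h k g)]
    ring

/-- Since `0 ≤ vA`, both arcs stay in the closed upper half plane, where the two angle
determinations agree. No full turn can occur, so the position of the vertex and of the line relative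
to the origin plays no role. -/
theorem measureReal_domainD_eq_Ipp (hk : 0 < k) (hh : 0 ≤ h) (hlt : k ^ 2 < lam) (hg0 : 0 < g)
    (hg : g ≤ √h) (hD : 0 ≤ Delta lam h k g) (hne : ϑ ^ 2 ≠ h) :
    ((gaussianReal 0 1).prod (gaussianReal 0 1)).real (domainD ϑ lam h k g) =
      Ipp ϑ lam h k g := by
  have hlam : 0 < lam := (sq_nonneg k).trans_lt hlt
  have hp : 0 < lam - k ^ 2 := by linarith
  have hS := branch_le_line_iff_mem_Icc (ϑ := ϑ) hlt hh hg0 hD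
  have hAB := vA_le_vB (h := h) (g := g) hlt
  have ea := branch_vA hlt.ne hD ((hS _).2 ⟨le_rfl, hAB⟩)
  have eb := branch_vB hlt.ne hD ((hS _).2 ⟨hAB, le_rfl⟩)
  have hB := vB_pos (h := h) hk hlt hg0
  have hA : 0 ≤ vA lam h k g := by
    have h1 : g ^ 2 ≤ h := (le_sqrt' hg0).1 hg
    have h2 := Delta_sub lam h k g
    have h3 : √(Delta lam h k g) ≤ g * k := sqrt_le_iff.2 ⟨by positivity, by nlinarith⟩
    exact div_nonneg (by linarith) hp.le
  have habs : |vA lam h k g| ≤ vB lam h k g := by rwa [abs_of_nonneg hA]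
  have tA := tanA_eq hlt.ne ea
  have tB := tanB_eq hlt.ne eb
  have eA := (phiA_eq (ϑ := ϑ) (h := h) (g := g) hlt.ne).symm
  have eB := (phiB_eq (ϑ := ϑ) (h := h) (g := g) hlt.ne).symm
  have eA' (hR : 0 < ϑ + √h) :
      argRight (branch ϑ lam h (vA lam h k g), vA lam h k g) = phiA ϑ lam h k g := by
    rw [argRight_of_nonneg (Or.inl (branch_pos hlam hR _)) (by exact hA), ea, eA]
  have e1 : phiA ϑ lam h k g + phiK k = phiK k + phiA ϑ lam h k g := by ring
  have e2 : phiB ϑ lam h k g + phiK k = phiK k + phiB ϑ lam h k g := by ring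
  have e3 : phiA ϑ lam h k g + π = π + phiA ϑ lam h k g := by ring
  have e4 : phiB ϑ lam h k g + π = π + phiB ϑ lam h k g := by ring
  have e5 : phiM ϑ lam h + π = π + phiM ϑ lam h := by ring
  unfold Ipp
  split_ifs with h1 h2
  · rw [tB] at h1
    have hR := add_sqrt_pos_of_tan hlam hh hne h1
    rw [measureReal_eq_of_Icc_of_green hAB hB hS ea eb (greenLine_of_nonneg hA hB hAB)
      (greenBranch_arcPos hlam hh hne hR habs (tangentNum_nonneg_of_tan hh h1)), eA, eB, eA' hR,
      e1, e2, arcPos, e3, e4, Ipp1]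
    ring
  · rw [tB, tA] at h2
    have hϑ := neg_of_tan_neg hh h2.1
    have hsq := sq_lt_of_tan hlam hh hne hϑ h2.2
    have hR := add_sqrt_pos_of_sq_lt hsq
    rw [measureReal_eq_of_Icc_of_green hAB hB hS ea eb (greenLine_of_nonneg hA hB hAB)
      (greenBranch_arcTangent hlam hϑ hsq (tangentNum_nonneg_of_tan hh h2.2)
        (le_of_tangentNum_nonpos hlam hϑ hsq hB (tangentNum_nonpos_of_tan hlam h2.1))),
      eA, eB, eA' hR, e1, e2, arcTangent, arcPos, arcNeg, e3, e5, Ipp2,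
      intervalIntegral.integral_symm (phiM ϑ lam h) (phiB ϑ lam h k g)]
    ring
  · have hA' : tanA ϑ lam h k g < 0 := by
      by_contra! h
      exact h2 ⟨not_le.1 h1, h⟩
    rw [tA] at hA'
    rw [measureReal_eq_of_Icc_of_green hAB hB hS ea eb (greenLine_of_nonneg hA hB hAB)
      (greenBranch_of_nonneg hlam hh hne hA hB hAB (neg_of_tan_neg hh hA')
        (tangentNum_nonpos_of_tan hlam hA')), ea, eA, eB, e1, e2, arcNeg, Ipp3,
      intervalIntegral.integral_symm (phiB ϑ lam h k g),
      intervalIntegral.integral_symm (phiK k + phiB ϑ lam h k g)]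
    ring

theorem measureReal_domainD_eq_In (hk : 0 < k) (hlam : 0 < lam) (hh : 0 ≤ h) (hlt : lam < k ^ 2)
    (hg : √(Delta lam h k g) < g * k) (hne : ϑ ^ 2 ≠ h) :
    ((gaussianReal 0 1).prod (gaussianReal 0 1)).real (domainD ϑ lam h k g) =
      In ϑ lam h k g := by
  have hp : lam - k ^ 2 < 0 := by linarith
  have hD := Delta_nonneg (g := g) hlam hlt hh
  have hS := branch_le_line_iff_le (ϑ := ϑ) (g := g) hk hlam hlt hh
  have ea := branch_vA hlt.ne' hD ((hS _).2 le_rfl)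
  have hA : vA lam h k g < 0 := div_neg_of_pos_of_neg (by linarith) hp
  -- The line crosses the axis to the right of the vertex, so `0 ≤ ϑ + √h` implies `0 ≤ ϑ + g` in
  -- the first three cases.
  have hgh : √h < g := by
    have h0 : 0 < g * k := (sqrt_nonneg _).trans_lt hg
    have hg0 : 0 < g := pos_of_mul_pos_left h0 hk.le
    rw [sqrt_lt' h0] at hg
    rw [sqrt_lt' hg0]
    have h2 := Delta_sub lam h k g
    nlinarith
  have tA := tanA_eq hlt.ne' ea
  have eA := (phiA_eq (ϑ := ϑ) (h := h) (g := g) hlt.ne').symm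
  have eA' : argRight (branch ϑ lam h (vA lam h k g), vA lam h k g) = -phiA ϑ lam h k g := by
    rw [argRight_of_neg (by exact hA), ea, eA]
  have e1 : -phiA ϑ lam h k g + phiK k = phiK k - phiA ϑ lam h k g := by ring
  have e3 : -phiA ϑ lam h k g + π = π - phiA ϑ lam h k g := by ring
  have e4 : phiLam lam + π = π + phiLam lam := by ring
  have e5 : phiM ϑ lam h + π = π + phiM ϑ lam h := by ring
  have e6 : -phiM ϑ lam h + π = π - phiM ϑ lam h := by ring
  have e7 : 2 * π - phiA ϑ lam h k g + phiK k = phiK k - phiA ϑ lam h k g + 2 * π := by ring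
  have hline (hc : 0 ≤ ϑ + g) : ∀ᶠ b in atTop, GreenLine ϑ k g (vA lam h k g)
      (-axisAngle (line ϑ k g (vA lam h k g), vA lam h k g)) b := by
    filter_upwards [eventually_gt_atTop 0] with b hb using greenLine_of_neg hA hb hc
  unfold In
  split_ifs with h1 h2 h3 h4
  · have hR : 0 < ϑ + √h := lt_of_le_of_ne (by positivity) (add_sqrt_ne_zero hh hne).symm
    have hbr := (eventually_ge_atTop |vA lam h k g|).mono fun b hb =>
      greenBranch_arcPos hlam hh hne hR hb (by unfold tangentNum; positivity)
    rw [measureReal_eq_of_Ici_of_green hlam hS ea (continuous_arcPos _) (hline (by linarith)) hbr,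
      eA, eA', e1, arcPos, e3, e4, In1]
    ring
  · rw [tA] at h2
    have hsq := sq_lt_of_tan hlam hh hne h2.1 h2.2
    have hR := add_sqrt_pos_of_sq_lt hsq
    have hbr := (eventually_ge_atTop (tangencyHeight ϑ lam h)).mono fun b hb =>
      greenBranch_arcTangent hlam h2.1 hsq (tangentNum_nonneg_of_tan hh h2.2) hb
    rw [measureReal_eq_of_Ici_of_green hlam hS ea (continuous_arcTangent _) (hline (by linarith))
      hbr, eA, eA', e1, arcTangent, arcPos, arcNeg, e3, e5, In2,
      intervalIntegral.integral_symm (phiM ϑ lam h) (phiLam lam)]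
    ring
  · rw [tA] at h3
    have hϑ := neg_of_tan_neg hh h3.1
    have hsq := sq_lt_of_add_sqrt_nonneg hh hne hϑ h3.2
    have hbr := (eventually_ge_atTop (tangencyHeight ϑ lam h)).mono fun b hb =>
      greenBranch_arcTangents hlam hϑ hsq hA (tangentNum_nonpos_of_tan hlam h3.1) hb
    rw [measureReal_eq_of_Ici_of_green hlam hS ea (continuous_arcTangents _) (hline (by linarith))
      hbr, eA, eA', e1, arcTangents, arcPos, arcNeg, arcNeg, e5, e6, In3,
      intervalIntegral.integral_symm (phiM ϑ lam h) (phiLam lam), integral_Upsilon_neg]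
    ring
  · have hbr := (eventually_gt_atTop (0 : ℝ)).mono fun b hb =>
      greenBranch_of_neg_left hlam hh hne hA hb h4.1
    rw [measureReal_eq_of_Ici_of_green hlam hS ea (continuous_arcNeg _) (hline h4.2) hbr,
      ea, eA, e1, arcNeg, In4, intervalIntegral.integral_symm (phiLam lam)]
    have := pi_ne_zero
    field_simp
    ring
  · have hA' : tanA ϑ lam h k g < 0 := by
      by_contra! h
      exact h2 ⟨not_le.1 h1, h⟩
    have hL : ϑ + √h < 0 := by
      by_contra! h
      exact h3 ⟨hA', h⟩
    have hc : ϑ + g < 0 := by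
      by_contra! h
      exact h4 ⟨hL, h⟩
    have hl := (eventually_gt_atTop (0 : ℝ)).mono fun b hb =>
      greenLine_of_neg_left (k := k) hA hb hc
    have hbr := (eventually_gt_atTop (0 : ℝ)).mono fun b hb =>
      greenBranch_of_neg_left hlam hh hne hA hb hL
    rw [measureReal_eq_of_Ici_of_green hlam hS ea (continuous_arcNeg _) hl hbr,
      ea, eA, e7, arcNeg, In5, intervalIntegral.integral_symm (phiLam lam),
      intervalIntegral.integral_symm (π / 2)]
    ring

theorem measureReal_domainD_eq_Ip (hk : 0 < k) (hlam : 0 < lam) (hh : 0 ≤ h) (hlt : lam < k ^ 2)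
    (hg : g * k ≤ √(Delta lam h k g)) (hne : ϑ ^ 2 ≠ h) :
    ((gaussianReal 0 1).prod (gaussianReal 0 1)).real (domainD ϑ lam h k g) =
      Ip ϑ lam h k g := by
  have hp : lam - k ^ 2 < 0 := by linarith
  have hD := Delta_nonneg (g := g) hlam hlt hh
  have hS := branch_le_line_iff_le (ϑ := ϑ) (g := g) hk hlam hlt hh
  have ea := branch_vA hlt.ne' hD ((hS _).2 le_rfl)
  have hA : 0 ≤ vA lam h k g := div_nonneg_of_nonpos (by linarith) hp.le
  have tA := tanA_eq hlt.ne' ea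
  have eA := (phiA_eq (ϑ := ϑ) (h := h) (g := g) hlt.ne').symm
  have eA' (hR : 0 < ϑ + √h) :
      argRight (branch ϑ lam h (vA lam h k g), vA lam h k g) = phiA ϑ lam h k g := by
    rw [argRight_of_nonneg (Or.inl (branch_pos hlam hR _)) (by exact hA), ea, eA]
  have e1 : phiA ϑ lam h k g + phiK k = phiK k + phiA ϑ lam h k g := by ring
  have e3 : phiA ϑ lam h k g + π = π + phiA ϑ lam h k g := by ring
  have e4 : phiLam lam + π = π + phiLam lam := by ring
  have e5 : phiM ϑ lam h + π = π + phiM ϑ lam h := by ring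
  have hl := ((eventually_gt_atTop (0 : ℝ)).and
    (eventually_ge_atTop (vA lam h k g))).mono fun b hb =>
    greenLine_of_nonneg (ϑ := ϑ) (k := k) (g := g) hA hb.1 hb.2
  unfold Ip
  split_ifs with h1 h2
  · have hR : 0 < ϑ + √h := lt_of_le_of_ne (by positivity) (add_sqrt_ne_zero hh hne).symm
    have hbr := (eventually_ge_atTop |vA lam h k g|).mono fun b hb =>
      greenBranch_arcPos hlam hh hne hR hb (by unfold tangentNum; positivity)
    rw [measureReal_eq_of_Ici_of_green hlam hS ea (continuous_arcPos _) hl hbr,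
      eA, eA' hR, e1, arcPos, e3, e4, Ip1, intervalIntegral.integral_symm (π / 2)]
    ring
  · rw [tA] at h2
    have hsq := sq_lt_of_tan hlam hh hne h2.1 h2.2
    have hR := add_sqrt_pos_of_sq_lt hsq
    have hbr := (eventually_ge_atTop (tangencyHeight ϑ lam h)).mono fun b hb =>
      greenBranch_arcTangent hlam h2.1 hsq (tangentNum_nonneg_of_tan hh h2.2) hb
    rw [measureReal_eq_of_Ici_of_green hlam hS ea (continuous_arcTangent _) hl hbr,
      eA, eA' hR, e1, arcTangent, arcPos, arcNeg, e3, e5, Ip2,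
      intervalIntegral.integral_symm (phiM ϑ lam h) (phiLam lam),
      intervalIntegral.integral_symm (π / 2)]
    ring
  · have hA' : tanA ϑ lam h k g < 0 := by
      by_contra! h
      exact h2 ⟨not_le.1 h1, h⟩
    rw [tA] at hA'
    have hbr := ((eventually_gt_atTop (0 : ℝ)).and
      (eventually_ge_atTop (vA lam h k g))).mono fun b hb =>
      greenBranch_of_nonneg hlam hh hne hA hb.1 hb.2 (neg_of_tan_neg hh hA')
        (tangentNum_nonpos_of_tan hlam hA')
    rw [measureReal_eq_of_Ici_of_green hlam hS ea (continuous_arcNeg _) hl hbr,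
      ea, eA, e1, arcNeg, Ip3, intervalIntegral.integral_symm (phiLam lam),
      intervalIntegral.integral_symm (π / 2)]
    ring

theorem measureReal_domainD_eq_zero (hlt : k ^ 2 < lam) (hh : 0 ≤ h)
    (hg : g ≤ 0 ∨ Delta lam h k g < 0) :
    ((gaussianReal 0 1).prod (gaussianReal 0 1)).real (domainD ϑ lam h k g) = 0 := by
  have hp : 0 < lam - k ^ 2 := by linarith
  have hsub : {v | branch ϑ lam h v ≤ line ϑ k g v} ⊆ {0} := by
    intro v hv
    rw [mem_ofPred_eq, branch_le_line_iff, sqrt_le_iff] at hv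
    obtain ⟨h1, h2⟩ := hv
    rcases hg with hg | hg
    · have h3 : (k * v + g) ^ 2 ≤ (k * v) ^ 2 := by nlinarith
      have h4 : (lam - k ^ 2) * v ^ 2 ≤ 0 := by nlinarith
      have h5 : v ^ 2 ≤ 0 := by
        by_contra! h
        exact absurd h4 (not_le.2 (mul_pos hp h))
      simpa using le_antisymm h5 (sq_nonneg v)
    · exfalso
      unfold Delta at hg
      -- Completing the square: with `Δ < 0` the quadratic is positive everywhere.
      have h3 : (lam - k ^ 2) * (lam * v ^ 2 + h - (k * v + g) ^ 2) =
          ((lam - k ^ 2) * v - k * g) ^ 2 - (h * (k ^ 2 - lam) + lam * g ^ 2) := by ring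
      have h4 : (lam - k ^ 2) * (lam * v ^ 2 + h - (k * v + g) ^ 2) ≤ 0 :=
        mul_nonpos_of_nonneg_of_nonpos hp.le (by linarith)
      nlinarith [sq_nonneg ((lam - k ^ 2) * v - k * g)]
  rw [measureReal_domainD]
  exact setIntegral_measure_zero _ (measure_mono_null hsub (measure_singleton 0))

end

end

end GaussHyperbola

theorem theorem8 {Ω : Type*} [MeasurableSpace Ω] (P : Measure Ω) [IsProbabilityMeasure P]
    (U V : Ω → ℝ)
    (hU : HasLaw U (gaussianReal 0 1) P) (hV : HasLaw V (gaussianReal 0 1) P)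
    (hUV : IndepFun U V P)
    (ϑ lam h k g : ℝ) (hk : 0 < k) (hlam : 0 < lam) (hh : 0 ≤ h) (hne : k ^ 2 ≠ lam)
    (hdef : (k ^ 2 < lam ∧ 0 < g ∧ 0 ≤ GaussHyperbola.Delta lam h k g) ∨ lam < k ^ 2 →
      ϑ ^ 2 ≠ h) :
    P.real {ω | (U ω, V ω) ∈ GaussHyperbola.domainD ϑ lam h k g} =
      GaussHyperbola.formula ϑ lam h k g := by
  rw [GaussHyperbola.prob_eq hU hV hUV (GaussHyperbola.measurableSet_domainD ϑ lam h k g)]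
  unfold GaussHyperbola.formula
  split_ifs with h1 h2 h3 h4
  · have hg : 0 < g := (Real.sqrt_nonneg h).trans_lt h1.2.1
    exact GaussHyperbola.measureReal_domainD_eq_Inp hk hh h1.1 h1.2.1 h1.2.2
      (hdef (Or.inl ⟨h1.1, hg, h1.2.2⟩))
  · exact GaussHyperbola.measureReal_domainD_eq_Ipp hk hh h2.1 h2.2.1 h2.2.2.1 h2.2.2.2
      (hdef (Or.inl ⟨h2.1, h2.2.1, h2.2.2.2⟩))
  · exact GaussHyperbola.measureReal_domainD_eq_In hk hlam hh h3.1 h3.2 (hdef (Or.inr h3.1))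
  · exact GaussHyperbola.measureReal_domainD_eq_Ip hk hlam hh h4.1 h4.2 (hdef (Or.inr h4.1))
  · have hlt : k ^ 2 < lam := by
      refine lt_of_le_of_ne (not_lt.1 fun h => ?_) hne
      rcases lt_or_ge (√(GaussHyperbola.Delta lam _ k g)) (g * k) with h5 | h5
      · exact h3 ⟨h, h5⟩
      · exact h4 ⟨h, h5⟩
    refine GaussHyperbola.measureReal_domainD_eq_zero hlt hh ?_
    by_contra! hc
    rcases lt_or_ge (√h) g with h5 | h5
    · exact h1 ⟨hlt, h5, hc.2⟩
    · exact h2 ⟨hlt, hc.1, h5, hc.2⟩
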